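/- Let $n\ge 1$ be an integer and let $p,q$ be coprime integers (of any sign; $(p,q)=(\pm1,0)$ and $(0,\pm1)$ are allowed). Let $S^3=\{(u,v)\in\mathbb C^2 : |u|^2+|v|^2=2\}$, let $T=\{|u|=|v|=1\}\subset S^3$ be the standard torus, and let $K^n_{p,q}\subset T$ be the torus link consisting of the $n$ parallel $(p,q)$ torus knots $$\{(e^{i\theta},e^{i\psi}) : q\theta-p\psi\equiv 2\pi k/n \pmod{2\pi}\},\qquad k\in\mathbb Z_n .$$ Then, for every base point, the fundamental group of the complement has the presentation $$\pi_1(S^3\setminus K^n_{p,q})\;\cong\;\bigl\langle \alpha,\ \beta,\ f_k\ (k\in\mathbb Z_n)\ \bigm|\ f_0,\ \ \alpha^p f_k\beta^{-q}f_k^{-1}\ (k\in\mathbb Z_n)\bigr\rangle .$$ The generators can be taken to be the following loops. Put $C=T\setminus K^n_{p,q}$, $A=\{|v|<1\}\cap S^3\,\cup\, C$ and $B=\{|u|<1\}\cap S^3\,\cup\, C$. Choose one base point $x_k$ $(k\in\mathbb Z_n)$ in each path component of $C$. Let $\alpha$ be the class of a loop in $A$ at $x_0$ along which the argument of $u$ increases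 by $2\pi$, and $\beta$ the class of a loop in $B$ at $x_0$ along which the argument of $v$ increases by $2\pi$. For each $k$ choose a path $a_k$ in $A$ and a path $b_k$ in $B$ from $x_0$ to $x_k$, with $a_0$ and $b_0$ constant, and let $f_k=a_k^{-1}b_k$ be the class of the loop that runs along $b_k$ and then back along $a_k$ (products of path classes are composed from right to left). For all such choices, $\pi_1(S^3\setminus K^n_{p,q},x_0)$ is presented by the elements $\alpha,\beta,f_k$ with the relators above. For $n=1$ one recovers the torus knot group: for every base point $\pi_1(S^3\setminus K^1_{p,q})\cong\langle\alpha,\beta\mid\alpha^p\beta^{-q}\rangle$, and the loops $\alpha,\beta$ above are generators realizing this presentation. -/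

import Mathlib

open scoped unitInterval

namespace TorusLink

/-- The 3-sphere `|u|² + |v|² = 2` in `ℂ²`. -/
def sphere : Set (ℂ × ℂ) := {z | ‖z.1‖ ^ 2 + ‖z.2‖ ^ 2 = 2}

/-- The standard torus `|u| = |v| = 1` in the 3-sphere. -/
def torus : Set (ℂ × ℂ) := {z | ‖z.1‖ = 1 ∧ ‖z.2‖ = 1}

/-- The open solid torus `|v| < 1` of the 3-sphere (the "interior" of the standard torus). -/
def solidA : Set (ℂ × ℂ) := {z | z ∈ sphere ∧ ‖z.2‖ < 1}

/-- The open solid torus `|u| < 1` of the 3-sphere (the "exterior" of the standard torus). -/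
def solidB : Set (ℂ × ℂ) := {z | z ∈ sphere ∧ ‖z.1‖ < 1}

/-- The `k`-th of `n` parallel copies of the `(p, q)` torus knot: the points
`(e^{iθ}, e^{iψ})` of the standard torus with `q θ - p ψ = 2π k / n` modulo `2π`. -/
def component (n : ℕ) (p q : ℤ) (k : ZMod n) : Set (ℂ × ℂ) :=
  {z | ∃ θ ψ : ℝ, z = (Complex.exp (θ * Complex.I), Complex.exp (ψ * Complex.I)) ∧
    ∃ m : ℤ, (q : ℝ) * θ - (p : ℝ) * ψ
      = 2 * Real.pi * ((k.val : ℝ) / (n : ℝ)) + 2 * Real.pi * (m : ℝ)}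

/-- The torus link made of `n` parallel `(p, q)` torus knots. -/
def link (n : ℕ) (p q : ℤ) : Set (ℂ × ℂ) := ⋃ k : ZMod n, component n p q k

/-- The link complement in the 3-sphere, as a topological space. -/
abbrev Complement (n : ℕ) (p q : ℤ) : Type := ↥(sphere \ link n p q)

/-- `C`: the standard torus without the link. -/
def regionC (n : ℕ) (p q : ℤ) : Set (ℂ × ℂ) := torus \ link n p q

/-- `A`: the solid torus `|v| < 1` together with `C`. -/
def regionA (n : ℕ) (p q : ℤ) : Set (ℂ × ℂ) := solidA ∪ regionC n p q

/-- `B`: the solid torus `|u| < 1` together with `C`. -/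
def regionB (n : ℕ) (p q : ℤ) : Set (ℂ × ℂ) := solidB ∪ regionC n p q

/-- The curve `g` in the plane winds exactly once counterclockwise around the origin: it has a
continuous choice of argument, which increases by `2π`. -/
def WindsOnce (g : I → ℂ) : Prop :=
  (∀ t, g t ≠ 0) ∧
  ∃ φ : C(I, ℝ), (∀ t, g t = (‖g t‖ : ℂ) * Complex.exp ((φ t : ℂ) * Complex.I)) ∧
    φ 1 - φ 0 = 2 * Real.pi

/-- The generators `α`, `β`, `f_k` (`k ∈ ℤ/n`) of the link group. -/
inductive Gen (n : ℕ) : Type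
  | alpha : Gen n
  | beta : Gen n
  | f (k : ZMod n) : Gen n

/-- The relators `f_0` and `α^p f_k β^{-q} f_k⁻¹` for all `k ∈ ℤ/n`. -/
def linkRels (n : ℕ) (p q : ℤ) : Set (FreeGroup (Gen n)) :=
  {FreeGroup.of (Gen.f 0)} ∪
    Set.range fun k : ZMod n =>
      FreeGroup.of Gen.alpha ^ p * FreeGroup.of (Gen.f k) *
        FreeGroup.of Gen.beta ^ (-q) * (FreeGroup.of (Gen.f k))⁻¹

/-- The relator `α^p β^{-q}` on two generators `α`, `β` (numbered `0`, `1`). -/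
def knotRels (p q : ℤ) : Set (FreeGroup (Fin 2)) :=
  {FreeGroup.of 0 ^ p * FreeGroup.of 1 ^ (-q)}

/-- The group `G` is presented by the generators `g i` subject to the relators `rels`: the
assignment `i ↦ g i` induces an isomorphism from the abstractly presented group onto `G`. -/
def HasPresentation {G ι : Type*} [Group G] (g : ι → G) (rels : Set (FreeGroup ι)) : Prop :=
  ∃ e : PresentedGroup rels ≃* G, ∀ i, e (PresentedGroup.of i) = g i

/-- The element of the fundamental group represented by a loop. In Mathlib's fundamental group
a product `g * h` is "first `h`, then `g`". -/
noncomputable def loopClass {X : Type*} [TopologicalSpace X] {x : X} (γ : Path x x) : FundamentalGroup X x :=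
  FundamentalGroup.fromPath (Path.Homotopic.Quotient.mk γ)

/-- The classes of the loops `α`, `β`, and of `f_k = a_k⁻¹ b_k`, which runs along `b_k` first
and then back along `a_k`. -/
noncomputable def generators {X : Type*} [TopologicalSpace X] {n : ℕ} {x : ZMod n → X}
    (α β : Path (x 0) (x 0)) (a b : ∀ k, Path (x 0) (x k)) :
    Gen n → FundamentalGroup X (x 0)
  | Gen.alpha => loopClass α
  | Gen.beta => loopClass β
  | Gen.f k => loopClass ((b k).trans (a k).symm)

end TorusLink

/-!
The complement `X` of the link is covered by two open sets `U` and `V`, the open solid tori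
`|v| < 1` and `|u| < 1` enlarged by a collar: the points off the coordinate axes whose radial
projection to the standard torus is not on the link. Each of them is homotopy equivalent to a
circle, and their intersection, which is the collar, consists of `n` strips, the components of
`0 < |v| < √2`, `n (q arg u - p arg v) / 2π ∉ ℤ`. The core of a strip winds `p` times around `U`
and `q` times around `V`. So the presentation is an instance of the theorem of Seifert and van
Kampen for two open sets with disconnected intersection, which is proved here in the case at hand.

What is used of `U` and `V` is recorded in `CirclePiece`: the universal covering, in which the angle
is replaced by a real number, is contractible, and hence a path is determined up to homotopy in `X`
by its endpoints and by the change of the angle (`CirclePiece.Winds.unique`). What is used of the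
strips is recorded in `StripSplitting`: two points whose arguments have the same integer part of
the height `n (q s - p t) / 2π` are joined by a path in the strip with prescribed changes of the two
arguments. The relations follow by moving the core of each strip to the base point through `U` and
through `V` (`StripSplitting.Marking.relation`).

The generators generate because a path can be subdivided into paths in `U` or `V`, and because a
change from one piece to the other in the `k`-th strip costs a factor `f k`
(`StripSplitting.Marking.mem_of_gens_mem`).

The relations suffice because the presented group `G` is the holonomy of a flat `G`-bundle over `X`:
going around `U` multiplies by `α`, going around `V` by `β`, and the transition function in the
strip of integer height `K` is `T K`, where `T : ℤ → G` is equivariant under change of the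
arguments by multiples of `2π` and takes the value `f k` on the strip of `x k`. As `p` and `q` are
coprime, the relations of `G` are exactly what makes such a `T` exist (`exists_equivariant`).
Parallel transport in this bundle, which is well defined on homotopy classes by the monodromy
theorem for covering spaces (`FlatGauge.exists_holonomy`), is up to conjugation a left inverse of
the map from `G` to the fundamental group
(`StripSplitting.Marking.toFundamentalGroup_injective`).
-/


/-! ### Holonomy of flat gauges -/

namespace TorusLink

open Filter Topology

/-- A family of (not necessarily continuous) frames `frame i`, with values in a group `G`, on the
members of an open cover `dom i` of `X`, such that on overlaps two frames differ by a locally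
constant function. Such a family is the same thing as a covering space of `X` with fibre `G` on
which `G` acts from the right. -/
structure FlatGauge (ι X G : Type*) [TopologicalSpace X] [Group G] where
  dom : ι → Set X
  isOpen_dom : ∀ i, IsOpen (dom i)
  exists_mem : ∀ x, ∃ i, x ∈ dom i
  frame : ι → X → G
  eventually_eq : ∀ i j x, x ∈ dom i → x ∈ dom j →
    ∀ᶠ y in 𝓝 x, frame i y * (frame j y)⁻¹ = frame i x * (frame j x)⁻¹

namespace FlatGauge

variable {ι X G : Type*} [TopologicalSpace X] [Group G] (Z : FlatGauge ι X G)

/-- The index of a member of the cover containing `x`. -/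
noncomputable def idx (x : X) : ι := (Z.exists_mem x).choose

lemma mem_idx (x : X) : x ∈ Z.dom (Z.idx x) := (Z.exists_mem x).choose_spec

/-- A `G`-valued function `g` along a curve `γ` is parallel if it is locally constant when read
in the frames. -/
def IsParallel (γ : I → X) (g : I → G) : Prop :=
  ∀ t, ∃ i, γ t ∈ Z.dom i ∧ ∀ᶠ t' in 𝓝 t, Z.frame i (γ t') * g t' = Z.frame i (γ t) * g t

lemma IsParallel.mul_right {Z : FlatGauge ι X G} {γ : I → X} {g : I → G} (h : Z.IsParallel γ g)
    (c : G) : Z.IsParallel γ (fun t => g t * c) := fun t => by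
  obtain ⟨i, hi, hg⟩ := h t
  refine ⟨i, hi, hg.mono fun t' ht' => ?_⟩
  simp only [← mul_assoc, ht']

lemma IsParallel.eventually_eq {Z : FlatGauge ι X G} {γ : I → X} {g : I → G}
    (h : Z.IsParallel γ g) (hγ : Continuous γ) (t : I) (j : ι) (hj : γ t ∈ Z.dom j) :
    ∀ᶠ t' in 𝓝 t, Z.frame j (γ t') * g t' = Z.frame j (γ t) * g t := by
  obtain ⟨i, hi, hg⟩ := h t
  filter_upwards [hg, (hγ.tendsto t).eventually (Z.eventually_eq j i _ hj hi)] with t' h1 h2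
  calc Z.frame j (γ t') * g t'
      = (Z.frame j (γ t') * (Z.frame i (γ t'))⁻¹) * (Z.frame i (γ t') * g t') := by group
    _ = Z.frame j (γ t) * g t := by rw [h1, h2]; group

section Discrete

variable [TopologicalSpace G] [DiscreteTopology G]

/-- The covering space described by a flat gauge, as a fibre bundle. -/
noncomputable def core : FiberBundleCore ι X G where
  baseSet := Z.dom
  isOpen_baseSet := Z.isOpen_dom
  indexAt := Z.idx
  mem_baseSet_at := Z.mem_idx
  coordChange i j x g := Z.frame j x * (Z.frame i x)⁻¹ * g
  coordChange_self i x _ v := by simp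
  continuousOn_coordChange i j := by
    rintro ⟨x, g⟩ ⟨⟨hi, hj⟩, -⟩
    apply ContinuousAt.continuousWithinAt
    have h1 : ∀ᶠ p : X × G in 𝓝 (x, g), p.2 = g :=
      (continuous_snd.tendsto (x, g)) ((isOpen_discrete {g}).mem_nhds rfl)
    have h2 : ∀ᶠ p : X × G in 𝓝 (x, g), Z.frame j p.1 * (Z.frame i p.1)⁻¹
        = Z.frame j x * (Z.frame i x)⁻¹ :=
      (continuous_fst.tendsto (x, g)).eventually (Z.eventually_eq j i x hj hi)
    refine (continuousAt_const (y := Z.frame j x * (Z.frame i x)⁻¹ * g)).congr ?_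
    filter_upwards [h1, h2] with p hp1 hp2
    rw [hp1, hp2]
  coordChange_comp i j k x _ v := by group

/-- The point of the covering space over `x` with coordinate `g`. -/
noncomputable def point (x : X) (g : G) : Z.core.TotalSpace := ⟨x, Z.frame (Z.idx x) x * g⟩

/-- The coordinate of a point of the covering space. -/
noncomputable def coord (e : Z.core.TotalSpace) : G :=
  (Z.frame (Z.idx e.1) e.1)⁻¹ * (show G from e.2)

lemma point_coord (e : Z.core.TotalSpace) : Z.point e.1 (Z.coord e) = e := by
  obtain ⟨x, v⟩ := e
  refine congrArg (Bundle.TotalSpace.mk x) ?_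
  exact mul_inv_cancel_left (G := G) _ v

lemma coord_point (x : X) (g : G) : Z.coord (Z.point x g) = g :=
  inv_mul_cancel_left (G := G) _ g

lemma continuous_point_iff {γ : I → X} (hγ : Continuous γ) (g : I → G) :
    Continuous (fun t => Z.point (γ t) (g t)) ↔ Z.IsParallel γ g := by
  have key : ∀ t, ContinuousAt (fun t => Z.point (γ t) (g t)) t ↔
      ∀ᶠ t' in 𝓝 t, Z.frame (Z.idx (γ t)) (γ t') * g t'
        = Z.frame (Z.idx (γ t)) (γ t) * g t := by
    intro t
    rw [FiberBundle.continuousAt_totalSpace]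
    have hval : ∀ t', (trivializationAt G Z.core.Fiber (γ t) (Z.point (γ t') (g t'))).2
        = Z.frame (Z.idx (γ t)) (γ t') * g t' := fun t' => by
      change Z.frame (Z.idx (γ t)) (γ t') * (Z.frame (Z.idx (γ t')) (γ t'))⁻¹ *
        (Z.frame (Z.idx (γ t')) (γ t') * g t') = _
      group
    change (ContinuousAt γ t ∧ ContinuousAt
      (fun t' => (trivializationAt G Z.core.Fiber (γ t) (Z.point (γ t') (g t'))).2) t) ↔ _
    simp only [hval, hγ.continuousAt, true_and]
    rw [ContinuousAt, nhds_discrete G, tendsto_pure]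
  rw [continuous_iff_continuousAt]
  constructor
  · exact fun h t => ⟨_, Z.mem_idx _, (key t).1 (h t)⟩
  · exact fun h t => (key t).2 (h.eventually_eq hγ t _ (Z.mem_idx _))

lemma isCoveringMap : IsCoveringMap (Bundle.TotalSpace.proj : Z.core.TotalSpace → X) :=
  FiberBundle.isCoveringMap (F := G) (E := Z.core.Fiber)

lemma monodromy_of_isParallel {x y : X} (γ : Path x y) (g : I → G) (h : Z.IsParallel γ g) :
    Z.isCoveringMap.monodromy (.mk γ) ⟨Z.point x (g 0), rfl⟩ = ⟨Z.point y (g 1), rfl⟩ := by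
  have hc := (Z.continuous_point_iff γ.continuous g).2 h
  have h0 : Z.point (γ 0) (g 0) = Z.point x (g 0) := by rw [γ.source]
  have := (Z.isCoveringMap.eq_liftPath_iff' (γ := γ) (e := Z.point x (g 0)) (γ_0 := γ.source)
    (Γ := ⟨_, hc⟩)).2 ⟨rfl, h0⟩
  refine Subtype.ext ?_
  have h1 : Z.point (γ 1) (g 1) = Z.point y (g 1) := by rw [γ.target]
  exact (DFunLike.congr_fun this 1).symm.trans h1

lemma exists_isParallel {x y : X} (γ : Path x y) : ∃ g : I → G, g 0 = 1 ∧ Z.IsParallel γ g := by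
  obtain ⟨Γ, h1, h2⟩ := Z.isCoveringMap.exists_path_lifts γ (Z.point x 1) γ.source
  have hΓ : ∀ t, (Γ t).1 = γ t := congrFun h1
  refine ⟨fun t => Z.coord (Γ t), by simp only [h2, coord_point], ?_⟩
  rw [← Z.continuous_point_iff γ.continuous]
  refine Γ.continuous.congr fun t => ?_
  rw [← hΓ, point_coord]

end Discrete

/-- The parallel transport of a flat gauge along homotopy classes of paths. As products in the
fundamental group are composed from right to left, it turns the concatenation of paths into
the product in the opposite order. -/
theorem exists_holonomy : ∃ hol : ∀ x y : X, Path.Homotopic.Quotient x y → G,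
    (∀ (x y z : X) (c : Path.Homotopic.Quotient x y) (c' : Path.Homotopic.Quotient y z),
      hol x z (c.trans c') = hol y z c' * hol x y c) ∧
    ∀ {x y : X} (γ : Path x y) (g : I → G), Z.IsParallel γ g → hol x y (.mk γ) = g 1 * (g 0)⁻¹ := by
  let _ : TopologicalSpace G := ⊥
  have : DiscreteTopology G := ⟨rfl⟩
  let hol : ∀ x y : X, Path.Homotopic.Quotient x y → G := fun x y c =>
    Z.coord (Z.isCoveringMap.monodromy c ⟨Z.point x 1, rfl⟩).1
  have hpar : ∀ {x y : X} (γ : Path x y) (g : I → G), Z.IsParallel γ g →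
      hol x y (.mk γ) = g 1 * (g 0)⁻¹ := fun {x y} γ g h => by
    have := Z.monodromy_of_isParallel γ _ (h.mul_right (g 0)⁻¹)
    simp only [mul_inv_cancel] at this
    simp only [hol, this, coord_point]
  refine ⟨hol, fun {x y z} c c' => ?_, hpar⟩
  obtain ⟨γ, rfl⟩ := Path.Homotopic.Quotient.mk_surjective c
  obtain ⟨γ', rfl⟩ := Path.Homotopic.Quotient.mk_surjective c'
  obtain ⟨g, hg0, hg⟩ := Z.exists_isParallel γ
  obtain ⟨g', hg0', hg'⟩ := Z.exists_isParallel γ'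
  have h1 := Z.monodromy_of_isParallel γ _ hg
  have h2 := Z.monodromy_of_isParallel γ' _ (hg'.mul_right (g 1))
  simp only [hg0, hg0', one_mul] at h1 h2
  rw [hpar γ g hg, hpar γ' g' hg', hg0, hg0']
  simp only [hol]
  rw [Z.isCoveringMap.monodromy_trans_apply, h1, h2, coord_point]
  simp

end FlatGauge

end TorusLink

/-! ### Arguments and winding of paths -/

namespace TorusLink

open Filter Topology

/-- The real number `s` is an argument of the complex number `w`. -/
def IsArg (w : ℂ) (s : ℝ) : Prop := w = (‖w‖ : ℂ) * Complex.exp ((s : ℂ) * Complex.I)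

lemma isArg_arg (w : ℂ) : IsArg w w.arg := (Complex.norm_mul_exp_arg_mul_I w).symm

lemma isArg_mul_exp {r : ℝ} (hr : 0 ≤ r) (s : ℝ) :
    IsArg ((r : ℂ) * Complex.exp ((s : ℂ) * Complex.I)) s := by
  rw [IsArg, norm_mul, Complex.norm_exp_ofReal_mul_I, mul_one, Complex.norm_real,
    Real.norm_of_nonneg hr]

lemma IsArg.add_int {w : ℂ} {s : ℝ} (h : IsArg w s) (i : ℤ) :
    IsArg w (s + 2 * Real.pi * i) := by
  rw [IsArg] at h ⊢
  convert h using 2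
  rw [Complex.exp_eq_exp_iff_exists_int]
  exact ⟨i, by push_cast; ring⟩

lemma IsArg.exists_int {w : ℂ} (hw : w ≠ 0) {s s' : ℝ} (h : IsArg w s) (h' : IsArg w s') :
    ∃ i : ℤ, s' = s + 2 * Real.pi * i := by
  have h1 := h'.symm.trans h
  have h2 := mul_left_cancel₀ (by simpa using hw) h1
  obtain ⟨i, hi⟩ := Complex.exp_eq_exp_iff_exists_int.1 h2
  refine ⟨i, ?_⟩
  have := congrArg Complex.im hi
  simp at this
  linarith

lemma exists_arg_lift (γ : C(I, ℂ)) (h : ∀ t, γ t ≠ 0) :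
    ∃ s : C(I, ℝ), ∀ t, IsArg (γ t) (s t) := by
  obtain ⟨Γ, hΓ, -⟩ := Complex.isCoveringMap_exp.exists_path_lifts
    (⟨fun t => ⟨γ t, h t⟩, by fun_prop⟩ : C(I, {z : ℂ // z ≠ 0})) (Complex.log (γ 0))
    (Subtype.ext (Complex.exp_log (h 0)).symm)
  refine ⟨⟨fun t => (Γ t).im, by fun_prop⟩, fun t => ?_⟩
  have ht : Complex.exp (Γ t) = γ t := congrArg Subtype.val (congrFun hΓ t)
  rw [IsArg, ← ht, Complex.norm_exp, Complex.ofReal_exp, ← Complex.exp_add]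
  simp [Complex.re_add_im]

lemma exists_local_arg {w₀ : ℂ} (hw : w₀ ≠ 0) : ∃ O : Set ℂ, IsOpen O ∧ w₀ ∈ O ∧
    ∃ s : ℂ → ℝ, ContinuousOn s O ∧ ∀ w ∈ O, IsArg w (s w) := by
  refine ⟨(fun w => w₀⁻¹ * w) ⁻¹' Complex.slitPlane,
    Complex.isOpen_slitPlane.preimage (by fun_prop), by simp [hw],
    fun w => w₀.arg + (w₀⁻¹ * w).arg, ?_, fun w _ => ?_⟩
  · refine continuousOn_const.add fun w hmem => ContinuousAt.continuousWithinAt ?_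
    exact (Complex.continuousAt_arg hmem).comp (f := fun w => w₀⁻¹ * w) (by fun_prop)
  · have h1 : w = w₀ * (w₀⁻¹ * w) := by field_simp
    rw [IsArg]
    have h2 : ‖w‖ = ‖w₀‖ * ‖w₀⁻¹ * w‖ := by rw [← norm_mul, ← h1]
    rw [h2, Complex.ofReal_mul, Complex.ofReal_add, add_mul, Complex.exp_add, mul_mul_mul_comm,
      Complex.norm_mul_exp_arg_mul_I, Complex.norm_mul_exp_arg_mul_I, ← h1]

/-- An open subset of `X` with a continuous nowhere vanishing function `angle` on it, such that
two points are joined by a path in the subset along which the argument of `angle` has prescribed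
values at the endpoints, and such that this path is unique up to homotopy in `X`. The two solid tori, slightly thickened, are of this kind. -/
structure CirclePiece (X : Type*) [TopologicalSpace X] where
  carrier : Set X
  angle : X → ℂ
  isOpen : IsOpen carrier
  continuous_angle : Continuous angle
  ne_zero : ∀ x ∈ carrier, angle x ≠ 0
  exists_path : ∀ x ∈ carrier, ∀ y ∈ carrier, ∀ s₀ s₁, IsArg (angle x) s₀ → IsArg (angle y) s₁ →
    ∃ (γ : Path x y) (s : C(I, ℝ)), (∀ t, γ t ∈ carrier) ∧ (∀ t, IsArg (angle (γ t)) (s t)) ∧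
      s 0 = s₀ ∧ s 1 = s₁
  homotopic : ∀ {x y : X} (γ γ' : Path x y) (s s' : C(I, ℝ)), (∀ t, γ t ∈ carrier) →
    (∀ t, γ' t ∈ carrier) → (∀ t, IsArg (angle (γ t)) (s t)) →
    (∀ t, IsArg (angle (γ' t)) (s' t)) → s 0 = s' 0 → s 1 = s' 1 → γ.Homotopic γ'

namespace CirclePiece

variable {X : Type*} [TopologicalSpace X] (U : CirclePiece X)

/-- The homotopy class `c` contains a path in the piece along which the argument of `angle`
increases by `d`. -/
def Winds {x y : X} (c : Path.Homotopic.Quotient x y) (d : ℝ) : Prop :=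
  ∃ γ : Path x y, .mk γ = c ∧ (∀ t, γ t ∈ U.carrier) ∧
    ∃ s : C(I, ℝ), (∀ t, IsArg (U.angle (γ t)) (s t)) ∧ s 1 - s 0 = d

variable {U}

lemma Winds.source_mem {x y : X} {c : Path.Homotopic.Quotient x y} {d : ℝ} (h : U.Winds c d) :
    x ∈ U.carrier := by
  obtain ⟨γ, -, h, -⟩ := h
  simpa using h 0

lemma Winds.target_mem {x y : X} {c : Path.Homotopic.Quotient x y} {d : ℝ} (h : U.Winds c d) :
    y ∈ U.carrier := by
  obtain ⟨γ, -, h, -⟩ := h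
  simpa using h 1

/-- The lift of the argument can be prescribed at the initial point. -/
lemma Winds.exists_lift {x y : X} {c : Path.Homotopic.Quotient x y} {d : ℝ} (h : U.Winds c d)
    {s₀ : ℝ} (hs₀ : IsArg (U.angle x) s₀) : ∃ γ : Path x y, .mk γ = c ∧ (∀ t, γ t ∈ U.carrier) ∧
    ∃ s : C(I, ℝ), (∀ t, IsArg (U.angle (γ t)) (s t)) ∧ s 0 = s₀ ∧ s 1 = s₀ + d := by
  have hx := h.source_mem
  obtain ⟨γ, hc, hγ, s, hs, hd⟩ := h
  have h0 := hs 0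
  rw [γ.source] at h0
  obtain ⟨i, hi⟩ := h0.exists_int (U.ne_zero x hx) hs₀
  refine ⟨γ, hc, hγ, ⟨fun t => s t + 2 * Real.pi * i, by fun_prop⟩,
    fun t => (hs t).add_int i, hi.symm, ?_⟩
  change s 1 + 2 * Real.pi * i = _
  rw [hi, ← hd]
  ring

lemma Winds.isArg {x y : X} {c : Path.Homotopic.Quotient x y} {d : ℝ} (h : U.Winds c d)
    {s₀ : ℝ} (hs₀ : IsArg (U.angle x) s₀) : IsArg (U.angle y) (s₀ + d) := by
  obtain ⟨γ, -, -, s, hs, -, h1⟩ := h.exists_lift hs₀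
  have := hs 1
  rwa [γ.target, h1] at this

lemma Winds.unique {x y : X} {c c' : Path.Homotopic.Quotient x y} {d : ℝ} (h : U.Winds c d)
    (h' : U.Winds c' d) : c = c' := by
  obtain ⟨γ, rfl, hγ, s, hs, h0, h1⟩ := h.exists_lift (isArg_arg _)
  obtain ⟨γ', rfl, hγ', s', hs', h0', h1'⟩ := h'.exists_lift (isArg_arg _)
  exact Path.Homotopic.Quotient.eq.2
    (U.homotopic γ γ' s s' hγ hγ' hs hs' (h0.trans h0'.symm) (h1.trans h1'.symm))

lemma Winds.refl {x : X} (hx : x ∈ U.carrier) : U.Winds (.refl x) 0 :=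
  ⟨.refl x, rfl, fun _ => hx, .const I (U.angle x).arg, fun _ => isArg_arg _, sub_self _⟩

lemma Winds.symm {x y : X} {c : Path.Homotopic.Quotient x y} {d : ℝ} (h : U.Winds c d) :
    U.Winds c.symm (-d) := by
  obtain ⟨γ, rfl, hγ, s, hs, hd⟩ := h
  refine ⟨γ.symm, rfl, fun t => hγ _, ⟨fun t => s (unitInterval.symm t), s.continuous.comp unitInterval.continuous_symm⟩,
    fun t => hs _, ?_⟩
  have h0 : s (unitInterval.symm 0) = s 1 := by rw [unitInterval.symm_zero]
  have h1 : s (unitInterval.symm 1) = s 0 := by rw [unitInterval.symm_one]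
  exact (congrArg₂ (· - ·) h1 h0).trans (by rw [← hd]; ring)

lemma Winds.trans {x y z : X} {c : Path.Homotopic.Quotient x y}
    {c' : Path.Homotopic.Quotient y z} {d d' : ℝ} (h : U.Winds c d) (h' : U.Winds c' d') :
    U.Winds (c.trans c') (d + d') := by
  obtain ⟨γ, rfl, hγ, s, hs, h0, h1⟩ := h.exists_lift (isArg_arg _)
  have hy : IsArg (U.angle y) (s 1) := by simpa using hs 1
  obtain ⟨γ', rfl, hγ', s', hs', h0', h1'⟩ := h'.exists_lift hy
  let S : Path (s 0) (s 1) := ⟨s, rfl, rfl⟩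
  let S' : Path (s 1) (s' 1) := ⟨s', h0', rfl⟩
  refine ⟨γ.trans γ', rfl, fun t => ?_, (S.trans S').toContinuousMap, fun t => ?_, ?_⟩
  · rw [Path.trans_apply]
    split_ifs
    exacts [hγ _, hγ' _]
  · change IsArg _ ((S.trans S') t)
    rw [Path.trans_apply, Path.trans_apply]
    split_ifs
    exacts [hs _, hs' _]
  · change (S.trans S') 1 - (S.trans S') 0 = _
    rw [Path.source, Path.target, h1', h1, h0]
    ring

lemma Winds.zpow {x : X} {c : FundamentalGroup X x} {d : ℝ} (h : U.Winds (x := x) (y := x) c d)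
    (j : ℤ) : U.Winds (x := x) (y := x) (c ^ j : FundamentalGroup X x) (j * d) := by
  induction j with
  | zero =>
    have e : (c ^ (0 : ℤ) : FundamentalGroup X x) = Path.Homotopic.Quotient.refl x := zpow_zero c
    have e' : ((0 : ℤ) : ℝ) * d = 0 := by simp
    rw [e, e']
    exact Winds.refl h.source_mem
  | succ m ih =>
    have e : (c ^ ((m : ℤ) + 1) : FundamentalGroup X x) =
      Path.Homotopic.Quotient.trans c (c ^ (m : ℤ)) := zpow_add_one c m
    have e' : (((m : ℤ) + 1 : ℤ) : ℝ) * d = d + ((m : ℤ) : ℝ) * d := by push_cast; ring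
    rw [e, e']
    exact Winds.trans h ih
  | pred m ih =>
    have e : (c ^ (-(m : ℤ) - 1) : FundamentalGroup X x) =
      Path.Homotopic.Quotient.trans (Path.Homotopic.Quotient.symm c) (c ^ (-(m : ℤ))) :=
      zpow_sub_one c (-m)
    have e' : ((-(m : ℤ) - 1 : ℤ) : ℝ) * d = -d + ((-(m : ℤ) : ℤ) : ℝ) * d := by
      push_cast; ring
    rw [e, e']
    exact Winds.trans h.symm ih

lemma exists_winds {x y : X} (γ : Path x y) (h : ∀ t, γ t ∈ U.carrier) :
    ∃ d, U.Winds (.mk γ) d := by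
  obtain ⟨s, hs⟩ := exists_arg_lift ⟨fun t => U.angle (γ t), U.continuous_angle.comp γ.continuous⟩
    fun t => U.ne_zero _ (h t)
  exact ⟨_, γ, rfl, h, s, hs, rfl⟩

/-- Points of the piece are joined by paths with any possible change of the argument. -/
lemma exists_path_winds {x y : X} (hx : x ∈ U.carrier) (hy : y ∈ U.carrier) {s₀ s₁ : ℝ}
    (h₀ : IsArg (U.angle x) s₀) (h₁ : IsArg (U.angle y) s₁) :
    ∃ γ : Path x y, U.Winds (.mk γ) (s₁ - s₀) := by
  obtain ⟨γ, s, hγ, hs, h0, h1⟩ := U.exists_path x hx y hy s₀ s₁ h₀ h₁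
  exact ⟨γ, γ, rfl, hγ, s, hs, by rw [h0, h1]⟩

/-- If `α` is a loop of winding number one, every loop in the piece is a power of `α`. -/
lemma Winds.exists_zpow_eq {x : X} {α c : FundamentalGroup X x} {d : ℝ}
    (hα : U.Winds (x := x) (y := x) α (2 * Real.pi)) (hc : U.Winds (x := x) (y := x) c d) :
    ∃ j : ℤ, c = α ^ j := by
  obtain ⟨j, hj⟩ := (isArg_arg _).exists_int (U.ne_zero x hc.source_mem)
    (hc.isArg (isArg_arg _))
  refine ⟨j, hc.unique ?_⟩
  convert hα.zpow j using 1
  linarith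

end CirclePiece

end TorusLink

/-! ### Spaces glued from two circle pieces along strips -/

namespace TorusLink

open Filter Topology

/-- The height of the point with arguments `s`, `t` of the torus. It is an integer exactly on the
link, and the strips between consecutive integers are the components of the complement. -/
noncomputable def height (n : ℕ) (p q : ℤ) (s t : ℝ) : ℝ :=
  n * (q * s - p * t) / (2 * Real.pi)

lemma height_add_int (n : ℕ) (p q : ℤ) (s t : ℝ) (i j : ℤ) :
    height n p q (s + 2 * Real.pi * i) (t + 2 * Real.pi * j)
      = height n p q s t + ((n * (q * i - p * j) : ℤ) : ℝ) := by
  have := Real.pi_ne_zero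
  simp only [height]
  push_cast
  field_simp
  ring

lemma floor_height_add_int (n : ℕ) (p q : ℤ) (s t : ℝ) (i j : ℤ) :
    ⌊height n p q (s + 2 * Real.pi * i) (t + 2 * Real.pi * j)⌋
      = ⌊height n p q s t⌋ + n * (q * i - p * j) := by
  rw [height_add_int, Int.floor_add_intCast]

/-- If `n` integers `κ k` represent all classes modulo `n` and the elements `F k` intertwine the
`p`-th power of `A` with the `q`-th power of `B`, then `κ k ↦ F k` extends to all integers
equivariantly for the action of `ℤ²` through `(i, j) ↦ n (q i - p j)`. -/
lemma exists_equivariant {G : Type*} [Group G] {n : ℕ} (hn : 0 < n) {p q : ℤ}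
    (hpq : IsCoprime p q) (A B : G) (F : ZMod n → G)
    (hF : ∀ k, A ^ p * F k = F k * B ^ q) (κ : ZMod n → ℤ)
    (hκ : Function.Injective fun k => (κ k : ZMod n)) :
    ∃ T : ℤ → G, (∀ K i j, T (K + n * (q * i - p * j)) = A ^ (-i) * T K * B ^ j) ∧
      ∀ k, T (κ k) = F k := by
  have : NeZero n := ⟨hn.ne'⟩
  obtain ⟨e, c, hec⟩ := hpq
  choose idx hidx using (Finite.injective_iff_surjective.1 hκ)
  have hFl : ∀ k (l : ℤ), A ^ (-(p * l)) * F k * B ^ (q * l) = F k := fun k l => by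
    have h1 : SemiconjBy (F k) (B ^ q) (A ^ p) := (hF k).symm
    have h2 : F k * (B ^ q) ^ l = (A ^ p) ^ l * F k := h1.zpow_right l
    rw [mul_assoc, zpow_mul, h2, zpow_neg, zpow_mul, inv_mul_cancel_left]
  refine ⟨fun K => A ^ (-(c * ((K - κ (idx K)) / n))) * F (idx K) *
    B ^ (-e * ((K - κ (idx K)) / n)), fun K i j => ?_, fun k => ?_⟩
  · have h1 : ((K + n * (q * i - p * j) : ℤ) : ZMod n) = (K : ZMod n) := by simp
    have h2 : (K + n * (q * i - p * j) - κ (idx K)) / n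
        = (K - κ (idx K)) / n + (q * i - p * j) := by
      rw [show K + n * (q * i - p * j) - κ (idx K) = (K - κ (idx K)) + n * (q * i - p * j) by ring,
        Int.add_mul_ediv_left _ _ (by exact_mod_cast hn.ne')]
    simp only [h1, h2]
    generalize (K - κ (idx K)) / n = m
    generalize idx K = k
    -- `F k` absorbs the multiple `-e * i - c * j` of the relation `(p, q)`.
    conv_rhs => rw [← hFl k (-e * i - c * j)]
    have e1 : -(c * (m + (q * i - p * j))) = -i + (-(c * m) + -(p * (-e * i - c * j))) := by
      linear_combination -i * hec
    have e2 : -e * (m + (q * i - p * j)) = q * (-e * i - c * j) + (-e * m + j) := by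
      linear_combination j * hec
    rw [e1, e2]
    simp only [zpow_add, mul_assoc]
  · have h1 : idx (κ k : ZMod n) = k := hκ (hidx _)
    simp [h1]

/-- If a continuous real function is `2π` times an integer near a point, it is constant there. -/
lemma eventually_eq_of_int {Y : Type*} [TopologicalSpace Y] {y : Y} {f : Y → ℝ}
    (hf : ContinuousAt f y) (h : ∀ᶠ z in 𝓝 y, ∃ i : ℤ, f z = 2 * Real.pi * i) :
    ∀ᶠ z in 𝓝 y, f z = f y := by
  have hpi := Real.pi_pos
  obtain ⟨i, hi⟩ := h.self_of_nhds
  have h1 : ∀ᶠ z in 𝓝 y, |f z - f y| < 2 * Real.pi := by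
    have := (hf.sub_const (f y)).abs
    refine this.eventually_lt_const ?_
    simpa using hpi
  filter_upwards [h, h1] with z ⟨j, hj⟩ hz
  rw [hj, hi, ← mul_sub, abs_mul, abs_of_pos (by positivity), mul_lt_iff_lt_one_right
    (by positivity)] at hz
  have : j - i = 0 := Int.abs_lt_one_iff.1 (by exact_mod_cast hz)
  rw [hj, hi, sub_eq_zero.1 this]

lemma eventually_floor_eq {Y : Type*} [TopologicalSpace Y] {y : Y} {f : Y → ℝ}
    (hf : ContinuousAt f y) (h : ∀ K : ℤ, f y ≠ K) : ∀ᶠ z in 𝓝 y, ⌊f z⌋ = ⌊f y⌋ := by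
  have h1 : (⌊f y⌋ : ℝ) < f y := lt_of_le_of_ne (Int.floor_le _) (h _).symm
  filter_upwards [hf.eventually_const_lt h1, hf.eventually_lt_const (Int.lt_floor_add_one (f y))]
    with z h2 h3
  exact Int.floor_eq_iff.2 ⟨h2.le, h3⟩

/-- A function of a point and of an argument `s` there, which `s ↦ s + 2π` multiplies from the
left by `A⁻¹`. -/
def IsTwisted {Y G : Type*} [Group G] (A : G) (h : Y → ℝ → G) : Prop :=
  ∀ y s (i : ℤ), h y (s + 2 * Real.pi * i) = A ^ (-i) * h y s

/-- The ratio of the values of a twisted function at two continuous arguments is locally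
constant. -/
lemma IsTwisted.eventually_eq {Y G : Type*} [Group G] [TopologicalSpace Y] {A : G}
    {h : Y → ℝ → G} (hh : IsTwisted A h) {w : Y → ℂ} {y : Y} {s s' : Y → ℝ}
    (hs : ContinuousAt s y) (hs' : ContinuousAt s' y)
    (hw : ∀ᶠ z in 𝓝 y, w z ≠ 0 ∧ IsArg (w z) (s z) ∧ IsArg (w z) (s' z)) :
    ∀ᶠ z in 𝓝 y, h z (s z) * (h z (s' z))⁻¹ = h y (s y) * (h y (s' y))⁻¹ := by
  have h1 : ∀ᶠ z in 𝓝 y, s z - s' z = s y - s' y := by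
    refine eventually_eq_of_int (f := fun z => s z - s' z) (hs.sub hs') (hw.mono ?_)
    rintro z ⟨h0, h1, h2⟩
    obtain ⟨i, hi⟩ := h2.exists_int h0 h1
    exact ⟨i, by rw [hi]; ring⟩
  obtain ⟨h0, h2, h3⟩ := hw.self_of_nhds
  obtain ⟨i, hi⟩ := h3.exists_int h0 h2
  filter_upwards [h1] with z hz
  have hz' : s z = s' z + 2 * Real.pi * i := by linarith
  rw [hz', hi, hh, hh]
  group

/-- A space covered by two circle pieces whose intersection is decomposed by the height into
strips, as a torus link complement is. The two pieces meet in strips in which a point is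
determined up to paths in the strip by the integer part of its height. -/
structure StripSplitting (n : ℕ) (p q : ℤ) (X : Type*) [TopologicalSpace X] where
  U : CirclePiece X
  V : CirclePiece X
  cover : ∀ x, x ∈ U.carrier ∨ x ∈ V.carrier
  height_ne : ∀ x ∈ U.carrier, x ∈ V.carrier → ∀ s t, IsArg (U.angle x) s → IsArg (V.angle x) t →
    ∀ K : ℤ, height n p q s t ≠ K
  join : ∀ x ∈ U.carrier, x ∈ V.carrier → ∀ y ∈ U.carrier, y ∈ V.carrier → ∀ s t s' t',
    IsArg (U.angle x) s → IsArg (V.angle x) t → IsArg (U.angle y) s' → IsArg (V.angle y) t' →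
    ⌊height n p q s t⌋ = ⌊height n p q s' t'⌋ →
    ∃ ω : Path.Homotopic.Quotient x y, U.Winds ω (s' - s) ∧ V.Winds ω (t' - t)

namespace StripSplitting

variable {n : ℕ} {p q : ℤ} {X G : Type*} [TopologicalSpace X] [Group G]
  (S : StripSplitting n p q X) (A B : G) (T : ℤ → G)

/-- The frame of the flat bundle over the first piece, at a point with argument `s`. -/
noncomputable def frameU (x : X) (s : ℝ) : G :=
  A ^ round (((S.U.angle x).arg - s) / (2 * Real.pi))

open Classical in
/-- The frame of the flat bundle over the second piece, at a point with argument `t`. Over the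
intersection of the pieces it is chosen such that the transition to the first frame is `T` of
the integer part of the height. -/
noncomputable def frameV (x : X) (t : ℝ) : G :=
  if x ∈ S.U.carrier then (T ⌊height n p q (S.U.angle x).arg t⌋)⁻¹
  else B ^ round (((S.V.angle x).arg - t) / (2 * Real.pi))

lemma round_sub_int (a s : ℝ) (i : ℤ) : round ((a - (s + 2 * Real.pi * i)) / (2 * Real.pi))
    = -i + round ((a - s) / (2 * Real.pi)) := by
  have := Real.pi_ne_zero
  rw [show (a - (s + 2 * Real.pi * i)) / (2 * Real.pi) = (a - s) / (2 * Real.pi) - i by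
    field_simp; ring, round_sub_intCast]
  ring

lemma isTwisted_frameU : IsTwisted A (S.frameU A) := fun x s i => by
  rw [frameU, round_sub_int, zpow_add, frameU]

variable {A B T} (hT : ∀ K i j, T (K + n * (q * i - p * j)) = A ^ (-i) * T K * B ^ j)
include hT

lemma isTwisted_frameV : IsTwisted B (S.frameV B T) := fun x t i => by
  unfold frameV
  split_ifs
  · have := floor_height_add_int n p q (S.U.angle x).arg t 0 i
    rw [Int.cast_zero, mul_zero, add_zero] at this
    rw [this, hT]
    simp
  · rw [round_sub_int, zpow_add]

lemma frameU_mul_frameV_inv {x : X} (hU : x ∈ S.U.carrier) {s : ℝ} (t : ℝ)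
    (hs : IsArg (S.U.angle x) s) :
    S.frameU A x s * (S.frameV B T x t)⁻¹ = T ⌊height n p q s t⌋ := by
  obtain ⟨i, rfl⟩ := (isArg_arg _).exists_int (S.U.ne_zero x hU) hs
  have := floor_height_add_int n p q (S.U.angle x).arg t i 0
  rw [Int.cast_zero, mul_zero, add_zero] at this
  rw [S.isTwisted_frameU A, this, hT, frameV, if_pos hU, frameU]
  simp

end StripSplitting

end TorusLink

/-! ### The flat bundle of a splitting -/

namespace TorusLink

open Filter Topology

variable {n : ℕ} {p q : ℤ} {X G : Type*} [TopologicalSpace X] [Group G]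

/-- A set with a frame on it that is obtained from a twisted function by inserting a continuous
argument. -/
def IsFrame (U : CirclePiece X) (h : X → ℝ → G) (P : Set X × (X → G)) : Prop :=
  IsOpen P.1 ∧ P.1 ⊆ U.carrier ∧ ∃ s : X → ℝ, ContinuousOn s P.1 ∧
    ∀ x ∈ P.1, IsArg (U.angle x) (s x) ∧ P.2 x = h x (s x)

omit [Group G] in
lemma exists_isFrame (U : CirclePiece X) (h : X → ℝ → G) {x : X} (hx : x ∈ U.carrier) :
    ∃ P, IsFrame U h P ∧ x ∈ P.1 := by
  obtain ⟨O, hO, hxO, s, hs, hsO⟩ := exists_local_arg (U.ne_zero x hx)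
  refine ⟨(U.carrier ∩ U.angle ⁻¹' O, fun y => h y (s (U.angle y))),
    ⟨U.isOpen.inter (hO.preimage U.continuous_angle), Set.inter_subset_left,
      fun y => s (U.angle y), ?_, fun y hy => ⟨hsO _ hy.2, rfl⟩⟩, hx, hxO⟩
  exact hs.comp U.continuous_angle.continuousOn fun y hy => hy.2

lemma IsFrame.eventually_eq {U : CirclePiece X} {A : G} {h : X → ℝ → G} (hh : IsTwisted A h)
    {P Q : Set X × (X → G)} (hP : IsFrame U h P) (hQ : IsFrame U h Q) {x : X} (hxP : x ∈ P.1)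
    (hxQ : x ∈ Q.1) : ∀ᶠ y in 𝓝 x, P.2 y * (Q.2 y)⁻¹ = P.2 x * (Q.2 x)⁻¹ := by
  obtain ⟨hPo, hPU, s, hs, hsP⟩ := hP
  obtain ⟨hQo, -, s', hs', hsQ⟩ := hQ
  have h1 := hPo.mem_nhds hxP
  have h2 := hQo.mem_nhds hxQ
  filter_upwards [h1, h2, hh.eventually_eq (w := U.angle) (hs.continuousAt h1)
    (hs'.continuousAt h2) (by
      filter_upwards [h1, h2] with y hy hy'
      exact ⟨U.ne_zero _ (hPU hy), (hsP y hy).1, (hsQ y hy').1⟩)] with y hy hy' hyy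
  rw [(hsP y hy).2, (hsQ y hy').2, hyy, (hsP x hxP).2, (hsQ x hxQ).2]

/-- A frame along a path in the piece is inverse to a parallel function. -/
lemma IsFrame.eventually_mul_eq {U : CirclePiece X} {A : G} {h : X → ℝ → G} (hh : IsTwisted A h)
    {P : Set X × (X → G)} (hP : IsFrame U h P) {x y : X} (γ : Path x y) (s : C(I, ℝ))
    (hs : ∀ t, IsArg (U.angle (γ t)) (s t)) {t : I} (ht : γ t ∈ P.1) :
    ∀ᶠ t' in 𝓝 t, P.2 (γ t') * (h (γ t') (s t'))⁻¹ = P.2 (γ t) * (h (γ t) (s t))⁻¹ := by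
  obtain ⟨hPo, hPU, s', hs', hsP⟩ := hP
  have h1 : ∀ᶠ t' in 𝓝 t, γ t' ∈ P.1 :=
    γ.continuous.continuousAt.eventually_mem (hPo.mem_nhds ht)
  have hh' : IsTwisted A fun t' => h (γ t') := fun t' => hh (γ t')
  have hc : ContinuousAt (fun t' => s' (γ t')) t :=
    (hs'.continuousAt (hPo.mem_nhds ht)).comp (f := γ) γ.continuous.continuousAt
  filter_upwards [h1, hh'.eventually_eq (w := fun t' => U.angle (γ t')) hc
    s.continuous.continuousAt (by
      filter_upwards [h1] with t' ht'
      exact ⟨U.ne_zero _ (hPU ht'), (hsP _ ht').1, hs t'⟩)] with t' ht' h2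
  rw [(hsP _ ht').2, (hsP _ ht).2, h2]

namespace StripSplitting

variable (S : StripSplitting n p q X) {A B : G} {T : ℤ → G}
  (hT : ∀ K i j, T (K + n * (q * i - p * j)) = A ^ (-i) * T K * B ^ j)
include hT

lemma eventually_frame_eq {P Q : Set X × (X → G)} (hP : IsFrame S.U (S.frameU A) P)
    (hQ : IsFrame S.V (S.frameV B T) Q) {x : X} (hxP : x ∈ P.1)
    (hxQ : x ∈ Q.1) : ∀ᶠ y in 𝓝 x, P.2 y * (Q.2 y)⁻¹ = P.2 x * (Q.2 x)⁻¹ := by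
  obtain ⟨hPo, hPU, s, hs, hsP⟩ := hP
  obtain ⟨hQo, hQV, t, ht, htQ⟩ := hQ
  have h1 := hPo.mem_nhds hxP
  have h2 := hQo.mem_nhds hxQ
  have hc : ContinuousAt (fun y => height n p q (s y) (t y)) x := by
    have := hs.continuousAt h1
    have := ht.continuousAt h2
    unfold height
    fun_prop
  have key : ∀ y ∈ P.1, y ∈ Q.1 → P.2 y * (Q.2 y)⁻¹ = T ⌊height n p q (s y) (t y)⌋ :=
    fun y hy hy' => by
      rw [(hsP y hy).2, (htQ y hy').2, S.frameU_mul_frameV_inv hT (hPU hy) _ (hsP y hy).1]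
  filter_upwards [h1, h2, eventually_floor_eq hc (S.height_ne x (hPU hxP) (hQV hxQ) _ _
    (hsP x hxP).1 (htQ x hxQ).1)] with y hy hy' hyy
  rw [key y hy hy', key x hxP hxQ, hyy]

/-- The flat bundle with trivial monodromy data `A`, `B` around the two pieces and transition
function `T` of the strips. -/
def gauge : FlatGauge {P : Set X × (X → G) //
    IsFrame S.U (S.frameU A) P ∨ IsFrame S.V (S.frameV B T) P} X G where
  dom P := P.1.1
  isOpen_dom := by rintro ⟨P, hP | hP⟩ <;> exact hP.1
  exists_mem x := by
    rcases S.cover x with h | h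
    · obtain ⟨P, hP, hx⟩ := exists_isFrame S.U (S.frameU A) h
      exact ⟨⟨P, .inl hP⟩, hx⟩
    · obtain ⟨P, hP, hx⟩ := exists_isFrame S.V (S.frameV B T) h
      exact ⟨⟨P, .inr hP⟩, hx⟩
  frame P := P.1.2
  eventually_eq := by
    rintro ⟨P, hP | hP⟩ ⟨Q, hQ | hQ⟩ x hxP hxQ
    · exact hP.eventually_eq (S.isTwisted_frameU A) hQ hxP hxQ
    · exact S.eventually_frame_eq hT hP hQ hxP hxQ
    · filter_upwards [S.eventually_frame_eq hT hQ hP hxQ hxP] with y hy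
      simpa using congrArg (·⁻¹) hy
    · exact hP.eventually_eq (S.isTwisted_frameV hT) hQ hxP hxQ

/-- The holonomy of the flat bundle determined by `A`, `B` and `T`, expressed for paths in one
of the two pieces by the values of the frames at the endpoints. -/
lemma exists_holonomy : ∃ hol : ∀ x y : X, Path.Homotopic.Quotient x y → G,
    (∀ (x y z : X) (c : Path.Homotopic.Quotient x y) (c' : Path.Homotopic.Quotient y z),
      hol x z (c.trans c') = hol y z c' * hol x y c) ∧
    (∀ {x y : X} (c : Path.Homotopic.Quotient x y) (d s : ℝ), S.U.Winds c d →
      IsArg (S.U.angle x) s → hol x y c = (S.frameU A y (s + d))⁻¹ * S.frameU A x s) ∧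
    (∀ {x y : X} (c : Path.Homotopic.Quotient x y) (d t : ℝ), S.V.Winds c d →
      IsArg (S.V.angle x) t → hol x y c = (S.frameV B T y (t + d))⁻¹ * S.frameV B T x t) := by
  obtain ⟨hol, hmul, hpar⟩ := (S.gauge hT).exists_holonomy
  refine ⟨hol, hmul, fun {x y} c d s hc hs => ?_, fun {x y} c d t hc ht => ?_⟩
  · obtain ⟨γ, rfl, hγ, θ, hθ, h0, h1⟩ := hc.exists_lift hs
    rw [hpar γ (fun t => (S.frameU A (γ t) (θ t))⁻¹) fun t => ?_]
    · simp [h0, h1]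
    · obtain ⟨P, hP, hx⟩ := exists_isFrame S.U (S.frameU A) (hγ t)
      exact ⟨⟨P, .inl hP⟩, hx, hP.eventually_mul_eq (S.isTwisted_frameU A) γ θ hθ hx⟩
  · obtain ⟨γ, rfl, hγ, θ, hθ, h0, h1⟩ := hc.exists_lift ht
    rw [hpar γ (fun t => (S.frameV B T (γ t) (θ t))⁻¹) fun t => ?_]
    · simp [h0, h1]
    · obtain ⟨P, hP, hx⟩ := exists_isFrame S.V (S.frameV B T) (hγ t)
      exact ⟨⟨P, .inr hP⟩, hx, hP.eventually_mul_eq (S.isTwisted_frameV hT) γ θ hθ hx⟩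

end StripSplitting

end TorusLink

/-! ### Markings, the relations and their completeness -/

namespace TorusLink

open Filter Topology

variable {X : Type*} [TopologicalSpace X]

lemma trans_symm_trans {x y z : X} (a : Path.Homotopic.Quotient x y)
    (c : Path.Homotopic.Quotient y z) : a.symm.trans (a.trans c) = c := by
  rw [← Path.Homotopic.Quotient.trans_assoc, Path.Homotopic.Quotient.symm_trans,
    Path.Homotopic.Quotient.refl_trans]

/-- Base points `x k` in the strips and paths between them in the two pieces, as they are used to
write down generators of the fundamental group. -/
structure StripSplitting.Marking {n : ℕ} {p q : ℤ} (S : StripSplitting n p q X)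
    (x : ZMod n → X) where
  α : Path (x 0) (x 0)
  β : Path (x 0) (x 0)
  a : ∀ k, Path (x 0) (x k)
  b : ∀ k, Path (x 0) (x k)
  winds_α : S.U.Winds (.mk α) (2 * Real.pi)
  winds_β : S.V.Winds (.mk β) (2 * Real.pi)
  winds_a : ∀ k, ∃ d, S.U.Winds (.mk (a k)) d
  winds_b : ∀ k, ∃ d, S.V.Winds (.mk (b k)) d
  a_zero : a 0 = Path.refl (x 0)
  b_zero : b 0 = Path.refl (x 0)
  eq_of_floor : ∀ k l s t s' t', IsArg (S.U.angle (x k)) s → IsArg (S.V.angle (x k)) t →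
    IsArg (S.U.angle (x l)) s' → IsArg (S.V.angle (x l)) t' →
    ((⌊height n p q s t⌋ : ℤ) : ZMod n) = (⌊height n p q s' t'⌋ : ℤ) → k = l

namespace StripSplitting.Marking

variable {n : ℕ} {p q : ℤ} {S : StripSplitting n p q X} {x : ZMod n → X} (M : S.Marking x)

/-- The generators of the fundamental group given by a marking. -/
noncomputable abbrev gens : Gen n → FundamentalGroup X (x 0) := generators M.α M.β M.a M.b

lemma memU (M : S.Marking x) (k : ZMod n) : x k ∈ S.U.carrier := (M.winds_a k).choose_spec.target_mem

lemma memV (M : S.Marking x) (k : ZMod n) : x k ∈ S.V.carrier := (M.winds_b k).choose_spec.target_mem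

lemma gens_f_zero : M.gens (Gen.f 0) = 1 := by
  change loopClass ((M.b 0).trans (M.a 0).symm) = 1
  rw [M.a_zero, M.b_zero, Path.refl_symm, Path.refl_trans_refl]
  rfl

lemma exists_winds_zero {P : CirclePiece X} {a : ∀ k, Path (x 0) (x k)}
    (h : ∀ k, ∃ d, P.Winds (.mk (a k)) d) (h0 : a 0 = Path.refl (x 0)) :
    ∃ d : ZMod n → ℝ, (∀ k, P.Winds (.mk (a k)) (d k)) ∧ d 0 = 0 := by
  choose d hd using h
  refine ⟨Function.update d 0 0, fun k => ?_, Function.update_self ..⟩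
  by_cases hk : k = 0
  · subst hk
    rw [Function.update_self, h0]
    exact CirclePiece.Winds.refl (hd 0).source_mem
  · rw [Function.update_of_ne hk]
    exact hd k

/-- The core of the strip through `x k` winds `p` times around the first and `q` times around
the second piece; moving it to the base point on either side gives the relation. -/
lemma relation (k : ZMod n) : M.gens .alpha ^ p * M.gens (.f k) =
    M.gens (.f k) * M.gens .beta ^ q := by
  obtain ⟨d, hd⟩ := M.winds_a k
  obtain ⟨e, he⟩ := M.winds_b k
  have hfl := floor_height_add_int n p q (S.U.angle (x k)).arg (S.V.angle (x k)).arg p q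
  rw [show q * p - p * q = 0 by ring, mul_zero, add_zero] at hfl
  obtain ⟨ω, hωU, hωV⟩ := S.join (x k) (M.memU k) (M.memV k) (x k) (M.memU k) (M.memV k) _ _ _ _
    (isArg_arg _) (isArg_arg _) ((isArg_arg _).add_int p) ((isArg_arg _).add_int q) hfl.symm
  have h1 : Path.Homotopic.Quotient.trans (Path.Homotopic.Quotient.mk (M.a k)).symm
      (M.gens .alpha ^ p) = ω.trans (Path.Homotopic.Quotient.mk (M.a k)).symm := by
    refine (hd.symm.trans (M.winds_α.zpow p)).unique ?_
    convert hωU.trans hd.symm using 1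
    ring
  have h2 : Path.Homotopic.Quotient.trans (M.gens .beta ^ q)
      (Path.Homotopic.Quotient.mk (M.b k)) = (Path.Homotopic.Quotient.mk (M.b k)).trans ω := by
    refine ((M.winds_β.zpow q).trans he).unique ?_
    convert he.trans hωV using 1
    ring
  change Path.Homotopic.Quotient.trans (Path.Homotopic.Quotient.trans
      (Path.Homotopic.Quotient.mk (M.b k)) (Path.Homotopic.Quotient.mk (M.a k)).symm)
      (M.gens .alpha ^ p) = Path.Homotopic.Quotient.trans (M.gens .beta ^ q)
      (Path.Homotopic.Quotient.trans
      (Path.Homotopic.Quotient.mk (M.b k)) (Path.Homotopic.Quotient.mk (M.a k)).symm)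
  rw [Path.Homotopic.Quotient.trans_assoc, h1, ← Path.Homotopic.Quotient.trans_assoc,
    ← Path.Homotopic.Quotient.trans_assoc, h2]

lemma lift_gens_eq_one : ∀ r ∈ linkRels n p q, FreeGroup.lift M.gens r = 1 := by
  rintro r (rfl | ⟨k, rfl⟩)
  · simpa using M.gens_f_zero
  · simp only [map_mul, map_zpow, map_inv, FreeGroup.lift_apply_of]
    rw [M.relation]
    group

/-- The homomorphism from the presented group to the fundamental group. -/
noncomputable def toFundamentalGroup :
    PresentedGroup (linkRels n p q) →* FundamentalGroup X (x 0) :=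
  PresentedGroup.toGroup M.lift_gens_eq_one

lemma presented_relation (k : ZMod n) :
    (PresentedGroup.of Gen.alpha : PresentedGroup (linkRels n p q)) ^ p
      * PresentedGroup.of (Gen.f k)
      = PresentedGroup.of (Gen.f k) * PresentedGroup.of Gen.beta ^ q := by
  have h : (PresentedGroup.of Gen.alpha : PresentedGroup (linkRels n p q)) ^ p
      * PresentedGroup.of (Gen.f k) * PresentedGroup.of Gen.beta ^ (-q)
      * (PresentedGroup.of (Gen.f k))⁻¹ = 1 :=
    PresentedGroup.one_of_mem (Or.inr ⟨k, rfl⟩)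
  rw [mul_inv_eq_one, zpow_neg, mul_inv_eq_iff_eq_mul] at h
  exact h

lemma presented_f_zero : (PresentedGroup.of (Gen.f 0) : PresentedGroup (linkRels n p q)) = 1 :=
  PresentedGroup.one_of_mem (Or.inl rfl)

/-- The holonomy of the flat bundle whose fibre is the presented group itself inverts
`toFundamentalGroup`. -/
theorem toFundamentalGroup_injective (hn : 0 < n) (hpq : IsCoprime p q) :
    Function.Injective M.toFundamentalGroup := by
  obtain ⟨d, hd, hd0⟩ := exists_winds_zero M.winds_a M.a_zero
  obtain ⟨e, he, he0⟩ := exists_winds_zero M.winds_b M.b_zero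
  have hs₀ := isArg_arg (S.U.angle (x 0))
  have ht₀ := isArg_arg (S.V.angle (x 0))
  set s₀ := (S.U.angle (x 0)).arg
  set t₀ := (S.V.angle (x 0)).arg
  set κ : ZMod n → ℤ := fun k => ⌊height n p q (s₀ + d k) (t₀ + e k)⌋ with hκ
  obtain ⟨T, hT, hTκ⟩ := exists_equivariant hn hpq
    (PresentedGroup.of Gen.alpha : PresentedGroup (linkRels n p q)) (PresentedGroup.of Gen.beta)
    (fun k => PresentedGroup.of (Gen.f k)) presented_relation κ (fun k l h =>
      M.eq_of_floor k l _ _ _ _ ((hd k).isArg hs₀) ((he k).isArg ht₀) ((hd l).isArg hs₀)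
        ((he l).isArg ht₀) h)
  obtain ⟨hol, hmul, hU, hV⟩ := S.exists_holonomy hT
  have hsymm : ∀ (y z : X) (w : Path.Homotopic.Quotient y z),
      hol _ _ w.symm = (hol _ _ w)⁻¹ := fun y z w => by
    have h1 := hmul _ _ _ w w.symm
    have h2 := hmul _ _ _ (Path.Homotopic.Quotient.refl y) (Path.Homotopic.Quotient.refl y)
    rw [Path.Homotopic.Quotient.refl_trans, right_eq_mul] at h2
    rw [Path.Homotopic.Quotient.trans_symm, h2] at h1
    exact eq_inv_of_mul_eq_one_left h1.symm
  set c := S.frameU (PresentedGroup.of Gen.alpha) (x 0) s₀ with hc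
  have hcT : ∀ k, c * (hol _ _ (.mk (M.a k)))⁻¹ * hol _ _ (.mk (M.b k)) *
      (S.frameV (PresentedGroup.of Gen.beta) T (x 0) t₀)⁻¹ = PresentedGroup.of (Gen.f k) := by
    intro k
    rw [hU _ _ _ (hd k) hs₀, hV _ _ _ (he k) ht₀, ← hTκ k, hκ,
      ← S.frameU_mul_frameV_inv hT (M.memU k) _ ((hd k).isArg hs₀), ← hc]
    group
  have hcV : c * (S.frameV (PresentedGroup.of Gen.beta) T (x 0) t₀)⁻¹ = 1 := by
    rw [hc, S.frameU_mul_frameV_inv hT (M.memU 0) _ hs₀]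
    have := hTκ 0
    rw [presented_f_zero] at this
    simpa only [hκ, hd0, he0, add_zero] using this
  let Ψ : FundamentalGroup X (x 0) →* PresentedGroup (linkRels n p q) :=
    MonoidHom.mk' (fun g => c * hol _ _ g * c⁻¹) fun g h => by
      change c * hol _ _ (Path.Homotopic.Quotient.trans h g) * c⁻¹ = _
      rw [hmul]
      group
  have hΨ : Ψ.comp M.toFundamentalGroup = MonoidHom.id _ := by
    ext i
    change Ψ (M.toFundamentalGroup (PresentedGroup.of i)) = PresentedGroup.of i
    rw [toFundamentalGroup, PresentedGroup.toGroup.of]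
    cases i with
    | alpha =>
      change c * hol _ _ (.mk M.α) * c⁻¹ = _
      have h2 := S.isTwisted_frameU (PresentedGroup.of Gen.alpha : PresentedGroup
        (linkRels n p q)) (x 0) s₀ 1
      rw [Int.cast_one, mul_one] at h2
      rw [hU _ _ _ M.winds_α hs₀, h2, hc]
      group
    | beta =>
      change c * hol _ _ (.mk M.β) * c⁻¹ = _
      have h2 := S.isTwisted_frameV hT (x 0) t₀ 1
      rw [Int.cast_one, mul_one] at h2
      rw [mul_inv_eq_one] at hcV
      rw [hV _ _ _ M.winds_β ht₀, h2, hcV]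
      group
    | f k =>
      change c * hol _ _ (Path.Homotopic.Quotient.trans (.mk (M.b k))
        (Path.Homotopic.Quotient.symm (.mk (M.a k)))) * c⁻¹ = _
      rw [hmul, hsymm, ← hcT k, ← mul_inv_eq_one.1 hcV]
      group
  intro g h hgh
  have := congrArg Ψ hgh
  exact (DFunLike.congr_fun hΨ g).symm.trans (this.trans (DFunLike.congr_fun hΨ h))

end StripSplitting.Marking

end TorusLink

/-! ### Generation -/

namespace TorusLink

open Filter Topology

variable {X : Type*} [TopologicalSpace X]

namespace StripSplitting.Marking

variable {n : ℕ} {p q : ℤ} {S : StripSplitting n p q X} {x : ZMod n → X} (M : S.Marking x)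

include M in
/-- Every point of the intersection of the pieces lies in the strip of some `x k`. -/
lemma exists_strip (hn : 0 < n) (hpq : IsCoprime p q) {y : X} (hyU : y ∈ S.U.carrier)
    (hyV : y ∈ S.V.carrier) :
    ∃ k, ∃ ω : Path.Homotopic.Quotient (x k) y, (∃ d, S.U.Winds ω d) ∧ ∃ d, S.V.Winds ω d := by
  have : NeZero n := ⟨hn.ne'⟩
  obtain ⟨e, c, hec⟩ := hpq
  have hinj : Function.Injective fun k : ZMod n => ((⌊height n p q (S.U.angle (x k)).arg
      (S.V.angle (x k)).arg⌋ : ℤ) : ZMod n) := fun k l h =>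
    M.eq_of_floor k l _ _ _ _ (isArg_arg _) (isArg_arg _) (isArg_arg _) (isArg_arg _) h
  obtain ⟨k, hk⟩ := Finite.injective_iff_surjective.1 hinj
    ((⌊height n p q (S.U.angle y).arg (S.V.angle y).arg⌋ : ℤ) : ZMod n)
  obtain ⟨m, hm⟩ := (ZMod.intCast_eq_intCast_iff_dvd_sub _ _ _).1 hk
  have hfl := floor_height_add_int n p q (S.U.angle (x k)).arg (S.V.angle (x k)).arg
    (c * m) (-e * m)
  rw [show q * (c * m) - p * (-e * m) = m by linear_combination m * hec, ← hm,
    add_sub_cancel] at hfl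
  obtain ⟨ω, hU, hV⟩ := S.join (x k) (M.memU k) (M.memV k) y hyU hyV _ _ _ _
    ((isArg_arg _).add_int _) ((isArg_arg _).add_int _) (isArg_arg _) (isArg_arg _) hfl
  exact ⟨k, ω, ⟨_, hU⟩, ⟨_, hV⟩⟩

/-- A class of paths from the base point is good for the subgroup `H` if, up to a factor from
`H`, it is represented by a path in one of the two pieces. -/
def IsGood (S : StripSplitting n p q X) {x₀ : X} (H : Subgroup (FundamentalGroup X x₀)) {y : X}
    (c : Path.Homotopic.Quotient x₀ y) : Prop :=
  ∃ h ∈ H, ∃ e : Path.Homotopic.Quotient x₀ y, ((∃ d, S.U.Winds e d) ∨ ∃ d, S.V.Winds e d) ∧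
    c = Path.Homotopic.Quotient.trans h e

variable (hn : 0 < n) (hpq : IsCoprime p q) {H : Subgroup (FundamentalGroup X (x 0))}
  (hH : ∀ i, M.gens i ∈ H)
include hn hpq hH

lemma exists_windsU_of_windsV {y : X} {e : Path.Homotopic.Quotient (x 0) y} {d : ℝ}
    (he : S.V.Winds e d) (hy : y ∈ S.U.carrier) :
    ∃ h ∈ H, ∃ e', (∃ d', S.U.Winds e' d') ∧ e = Path.Homotopic.Quotient.trans h e' := by
  obtain ⟨k, ω, ⟨dU, hU⟩, ⟨dV, hV⟩⟩ := M.exists_strip hn hpq hy he.target_mem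
  obtain ⟨da, ha⟩ := M.winds_a k
  obtain ⟨db, hb⟩ := M.winds_b k
  obtain ⟨j, hj⟩ := M.winds_β.exists_zpow_eq ((he.trans hV.symm).trans hb.symm)
  refine ⟨M.gens (.f k) * M.gens .beta ^ j, H.mul_mem (hH _) (H.zpow_mem (hH _) j), _,
    ⟨_, ha.trans hU⟩, ?_⟩
  change e = ((M.gens .beta ^ j : Path.Homotopic.Quotient _ _).trans
    (Path.Homotopic.Quotient.trans (.mk (M.b k)) (Path.Homotopic.Quotient.mk (M.a k)).symm)).trans
    (Path.Homotopic.Quotient.trans (.mk (M.a k)) ω)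
  have hj' : (M.gens .beta ^ j : Path.Homotopic.Quotient _ _) = _ := hj.symm
  rw [hj']
  simp only [Path.Homotopic.Quotient.trans_assoc, trans_symm_trans,
    Path.Homotopic.Quotient.symm_trans, Path.Homotopic.Quotient.trans_refl]

lemma exists_windsV_of_windsU {y : X} {e : Path.Homotopic.Quotient (x 0) y} {d : ℝ}
    (he : S.U.Winds e d) (hy : y ∈ S.V.carrier) :
    ∃ h ∈ H, ∃ e', (∃ d', S.V.Winds e' d') ∧ e = Path.Homotopic.Quotient.trans h e' := by
  obtain ⟨k, ω, ⟨dU, hU⟩, ⟨dV, hV⟩⟩ := M.exists_strip hn hpq he.target_mem hy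
  obtain ⟨da, ha⟩ := M.winds_a k
  obtain ⟨db, hb⟩ := M.winds_b k
  obtain ⟨j, hj⟩ := M.winds_α.exists_zpow_eq ((he.trans hU.symm).trans ha.symm)
  have hf : (M.gens (.f k))⁻¹ = (Path.Homotopic.Quotient.trans (.mk (M.a k))
      (Path.Homotopic.Quotient.mk (M.b k)).symm : FundamentalGroup X (x 0)) := by
    rw [inv_eq_iff_mul_eq_one]
    change Path.Homotopic.Quotient.trans (Path.Homotopic.Quotient.trans (.mk (M.a k))
      (Path.Homotopic.Quotient.mk (M.b k)).symm) (Path.Homotopic.Quotient.trans (.mk (M.b k))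
      (Path.Homotopic.Quotient.mk (M.a k)).symm) = .refl _
    simp only [Path.Homotopic.Quotient.trans_assoc, trans_symm_trans,
      Path.Homotopic.Quotient.trans_symm]
  refine ⟨(M.gens (.f k))⁻¹ * M.gens .alpha ^ j, H.mul_mem (H.inv_mem (hH _))
    (H.zpow_mem (hH _) j), _, ⟨_, hb.trans hV⟩, ?_⟩
  rw [hf]
  change e = ((M.gens .alpha ^ j : Path.Homotopic.Quotient _ _).trans
    (Path.Homotopic.Quotient.trans (.mk (M.a k)) (Path.Homotopic.Quotient.mk (M.b k)).symm)).trans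
    (Path.Homotopic.Quotient.trans (.mk (M.b k)) ω)
  have hj' : (M.gens .alpha ^ j : Path.Homotopic.Quotient _ _) = _ := hj.symm
  rw [hj']
  simp only [Path.Homotopic.Quotient.trans_assoc, trans_symm_trans,
    Path.Homotopic.Quotient.symm_trans, Path.Homotopic.Quotient.trans_refl]

/-- Good classes remain good when they are continued by a path in one of the pieces. -/
lemma IsGood.trans {y z : X} {c : Path.Homotopic.Quotient (x 0) y} (hc : IsGood S H c)
    {ε : Path.Homotopic.Quotient y z} (hε : (∃ d, S.U.Winds ε d) ∨ ∃ d, S.V.Winds ε d) :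
    IsGood S H (c.trans ε) := by
  obtain ⟨h, hh, e, he, rfl⟩ := hc
  rw [Path.Homotopic.Quotient.trans_assoc]
  rcases hε with ⟨d, hd⟩ | ⟨d, hd⟩
  · obtain ⟨h', hh', e', ⟨d', he'⟩, rfl⟩ : ∃ h ∈ H, ∃ e', (∃ d', S.U.Winds e' d') ∧
        e = Path.Homotopic.Quotient.trans h e' := by
      rcases he with ⟨d', he⟩ | ⟨d', he⟩
      · exact ⟨1, H.one_mem, e, ⟨d', he⟩, (Path.Homotopic.Quotient.refl_trans e).symm⟩
      · exact M.exists_windsU_of_windsV hn hpq hH he hd.source_mem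
    refine ⟨h' * h, H.mul_mem hh' hh, e'.trans ε, .inl ⟨_, he'.trans hd⟩, ?_⟩
    rw [FundamentalGroup.mul_def]
    simp only [Path.Homotopic.Quotient.trans_assoc]
  · obtain ⟨h', hh', e', ⟨d', he'⟩, rfl⟩ : ∃ h ∈ H, ∃ e', (∃ d', S.V.Winds e' d') ∧
        e = Path.Homotopic.Quotient.trans h e' := by
      rcases he with ⟨d', he⟩ | ⟨d', he⟩
      · exact M.exists_windsV_of_windsU hn hpq hH he hd.source_mem
      · exact ⟨1, H.one_mem, e, ⟨d', he⟩, (Path.Homotopic.Quotient.refl_trans e).symm⟩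
    refine ⟨h' * h, H.mul_mem hh' hh, e'.trans ε, .inr ⟨_, he'.trans hd⟩, ?_⟩
    rw [FundamentalGroup.mul_def]
    simp only [Path.Homotopic.Quotient.trans_assoc]

/-- All classes are good, because a path can be subdivided into paths in the pieces. -/
lemma isGood_mk {y : X} (γ : Path (x 0) y) : IsGood S H (.mk γ) := by
  obtain ⟨t, ht0, htm, ⟨N, hN⟩, hsub⟩ := exists_monotone_Icc_subset_open_cover_unitInterval
    (c := fun i : Bool => γ ⁻¹' (if i then S.U.carrier else S.V.carrier))
    (fun i => by
      cases i
      exacts [S.V.isOpen.preimage γ.continuous, S.U.isOpen.preimage γ.continuous])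
    (fun s _ => Set.mem_iUnion.2 <| by
      rcases S.cover (γ s) with h | h
      exacts [⟨true, h⟩, ⟨false, h⟩])
  have key : ∀ m, IsGood S H
      (.mk ((γ.subpath (t 0) (t m)).cast (by rw [ht0, γ.source]) rfl)) := by
    intro m
    induction m with
    | zero =>
      refine ⟨1, H.one_mem, _, .inl (S.U.exists_winds _ fun r => ?_),
        (Path.Homotopic.Quotient.refl_trans _).symm⟩
      rw [Path.cast_coe, Path.subpath_self, Path.refl_apply, ht0, γ.source]
      exact M.memU 0
    | succ m ih =>
      have hw : (∃ d, S.U.Winds (.mk (γ.subpath (t m) (t (m + 1)))) d) ∨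
          ∃ d, S.V.Winds (.mk (γ.subpath (t m) (t (m + 1)))) d := by
        have hr : ∀ r, γ.subpath (t m) (t (m + 1)) r ∈ γ '' Set.Icc (t m) (t (m + 1)) :=
          fun r => by
            rw [← γ.range_subpath_of_le _ _ (htm m.le_succ)]
            exact ⟨r, rfl⟩
        obtain ⟨i, hi⟩ := hsub m
        cases i with
        | true =>
          refine .inl (S.U.exists_winds _ fun r => ?_)
          obtain ⟨r', hr', h⟩ := hr r
          rw [← h]
          exact hi hr'
        | false =>
          refine .inr (S.V.exists_winds _ fun r => ?_)
          obtain ⟨r', hr', h⟩ := hr r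
          rw [← h]
          exact hi hr'
      have := IsGood.trans M hn hpq hH ih hw
      convert this using 1
      refine Path.Homotopic.Quotient.eq.2 ?_
      exact ⟨((Path.Homotopy.subpathTransSubpath γ (t 0) (t m) (t (m + 1))).symm.pathCast
        (by rw [ht0, γ.source]) rfl)⟩
  have hcast : ∀ {z : X} (c : Path.Homotopic.Quotient (x 0) z) (hz : y = z), IsGood S H c →
      IsGood S H (c.cast rfl hz) := by
    rintro z c rfl h
    rwa [Path.Homotopic.Quotient.cast_rfl_rfl]
  have hy : y = γ (t N) := by rw [hN N le_rfl, γ.target]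
  have h1 := hcast _ hy (key N)
  rw [← Path.Homotopic.Quotient.mk_cast] at h1
  convert h1 using 2
  ext r
  simp [Path.subpath, ht0, hN N le_rfl]

theorem mem_of_gens_mem (c : FundamentalGroup X (x 0)) : c ∈ H := by
  obtain ⟨γ, rfl⟩ := Path.Homotopic.Quotient.mk_surjective c
  obtain ⟨h, hh, e, he, hc⟩ := M.isGood_mk hn hpq hH γ
  have he' : (e : FundamentalGroup X (x 0)) ∈ H := by
    rcases he with ⟨d, he⟩ | ⟨d, he⟩
    · obtain ⟨j, rfl⟩ := M.winds_α.exists_zpow_eq he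
      exact H.zpow_mem (hH .alpha) j
    · obtain ⟨j, rfl⟩ := M.winds_β.exists_zpow_eq he
      exact H.zpow_mem (hH .beta) j
  rw [hc]
  exact H.mul_mem he' hh

omit hH in
theorem hasPresentation : HasPresentation M.gens (linkRels n p q) := by
  have h : ∀ i, M.toFundamentalGroup (PresentedGroup.of i) = M.gens i := fun i =>
    PresentedGroup.toGroup.of M.lift_gens_eq_one
  have hsurj : Function.Surjective M.toFundamentalGroup := fun c =>
    M.mem_of_gens_mem hn hpq (H := M.toFundamentalGroup.range) (fun i => ⟨_, h i⟩) c
  exact ⟨MulEquiv.ofBijective M.toFundamentalGroup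
    ⟨M.toFundamentalGroup_injective hn hpq, hsurj⟩, h⟩

end StripSplitting.Marking

end TorusLink

/-! ### The two thickened solid tori -/

namespace TorusLink

open Filter Topology

/-- A circle piece of a homeomorphic space. -/
def CirclePiece.comap {X Y : Type*} [TopologicalSpace X] [TopologicalSpace Y]
    (U : CirclePiece Y) (e : X ≃ₜ Y) : CirclePiece X where
  carrier := e ⁻¹' U.carrier
  angle := U.angle ∘ e
  isOpen := U.isOpen.preimage e.continuous
  continuous_angle := U.continuous_angle.comp e.continuous
  ne_zero x hx := U.ne_zero _ hx
  exists_path x hx y hy s₀ s₁ hs₀ hs₁ := by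
    obtain ⟨γ, s, hγ, hs, h0, h1⟩ := U.exists_path _ hx _ hy s₀ s₁ hs₀ hs₁
    have he : ∀ t, e (((γ.map e.symm.continuous).cast (e.symm_apply_apply x).symm
        (e.symm_apply_apply y).symm) t) = γ t := fun t => by simp
    exact ⟨_, s, fun t => by rw [Set.mem_preimage, he]; exact hγ t,
      fun t => by rw [Function.comp_apply, he]; exact hs t, h0, h1⟩
  homotopic γ γ' s s' hγ hγ' hs hs' h0 h1 := by
    have h := (U.homotopic (γ.map e.continuous) (γ'.map e.continuous) s s' hγ hγ' hs hs' h0 h1).map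
      ⟨e.symm, e.symm.continuous⟩
    have := h.pathCast (e.symm_apply_apply _).symm (e.symm_apply_apply _).symm
    convert this using 1 <;>
    · ext t
      simp

/-- The points of `ℂ²` whose radial projection to the standard torus is defined and not in `L`. -/
def collar (L : Set (ℂ × ℂ)) : Set (ℂ × ℂ) :=
  {z | z.1 ≠ 0 ∧ z.2 ≠ 0 ∧ (z.1 / (‖z.1‖ : ℂ), z.2 / (‖z.2‖ : ℂ)) ∉ L}

lemma isOpen_collar {L : Set (ℂ × ℂ)} (hL : IsClosed L) : IsOpen (collar L) := by
  have hO : IsOpen {z : ℂ × ℂ | z.1 ≠ 0 ∧ z.2 ≠ 0} :=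
    (isOpen_ne.preimage continuous_fst).inter (isOpen_ne.preimage continuous_snd)
  have hc : ContinuousOn (fun z : ℂ × ℂ => (z.1 / (‖z.1‖ : ℂ), z.2 / (‖z.2‖ : ℂ)))
      {z : ℂ × ℂ | z.1 ≠ 0 ∧ z.2 ≠ 0} := by
    refine ContinuousOn.prodMk (ContinuousOn.div (by fun_prop) (by fun_prop) ?_)
      (ContinuousOn.div (by fun_prop) (by fun_prop) ?_)
    · rintro z ⟨h1, h2⟩
      simpa using h1
    · rintro z ⟨h1, h2⟩
      simpa using h2
  convert hc.isOpen_inter_preimage hO hL.isOpen_compl using 1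
  ext z
  simp [collar, and_assoc]

lemma IsArg.div_norm {w : ℂ} (hw : w ≠ 0) {s : ℝ} (h : IsArg w s) :
    w / (‖w‖ : ℂ) = Complex.exp ((s : ℂ) * Complex.I) := by
  rw [div_eq_iff (by simpa using hw), mul_comm]
  exact h

/-- The universal covering of the thickened solid torus: the angle in the first factor is replaced
by a real number, the radius is determined by the second factor. -/
def unrolled (L : Set (ℂ × ℂ)) : Set (ℝ × ℂ) :=
  {w | ‖w.2‖ < 1 ∨ w.2 ≠ 0 ∧ ‖w.2‖ ^ 2 < 2 ∧
    (Complex.exp ((w.1 : ℂ) * Complex.I), w.2 / (‖w.2‖ : ℂ)) ∉ L}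

lemma unrolled_smul {L : Set (ℂ × ℂ)} {w : ℝ × ℂ} (hw : w ∈ unrolled L) {c : ℝ} (h0 : 0 ≤ c)
    (h1 : c ≤ 1) : (w.1, (c : ℂ) * w.2) ∈ unrolled L := by
  have hn : ‖(c : ℂ) * w.2‖ = c * ‖w.2‖ := by simp [abs_of_nonneg h0]
  rcases h0.eq_or_lt with rfl | hpos
  · left
    simp
  rcases hw with hw | ⟨hw, hw2, hL⟩
  · left
    change ‖(c : ℂ) * w.2‖ < 1
    rw [hn]
    nlinarith [norm_nonneg w.2]
  · refine .inr ⟨mul_ne_zero (by exact_mod_cast hpos.ne') hw, ?_, ?_⟩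
    · change ‖(c : ℂ) * w.2‖ ^ 2 < 2
      rw [hn, mul_pow]
      have : c ^ 2 ≤ 1 := pow_le_one₀ h0 h1
      nlinarith [sq_nonneg ‖w.2‖]
    · change (_, (c : ℂ) * w.2 / (‖(c : ℂ) * w.2‖ : ℂ)) ∉ L
      rwa [hn, Complex.ofReal_mul, mul_div_mul_left _ _ (by exact_mod_cast hpos.ne')]

instance (L : Set (ℂ × ℂ)) : ContractibleSpace (unrolled L) := by
  rw [contractible_iff_id_nullhomotopic]
  have h0 : ∀ s : ℝ, ((s, 0) : ℝ × ℂ) ∈ unrolled L := fun s => .inl (by simp)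
  refine ⟨⟨(0, 0), h0 0⟩, .trans (g := ⟨fun w => ⟨(w.1.1, 0), h0 _⟩, by fun_prop⟩) ⟨?_⟩ ⟨?_⟩⟩
  · exact {
      toFun := fun P => ⟨(P.2.1.1, (((1 - (P.1 : ℝ) : ℝ)) : ℂ) * P.2.1.2),
        unrolled_smul P.2.2 (by linarith [P.1.2.2]) (by linarith [P.1.2.1])⟩
      continuous_toFun := by fun_prop
      map_zero_left := fun w => by simp
      map_one_left := fun w => by simp }
  · exact {
      toFun := fun P => ⟨((1 - (P.1 : ℝ)) * P.2.1.1, 0), h0 _⟩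
      continuous_toFun := by fun_prop
      map_zero_left := fun w => by simp
      map_one_left := fun w => by simp }

variable {L : Set (ℂ × ℂ)}

/-- The point of the complement of `L` over a point of the universal covering. -/
noncomputable def rolled (hL : L ⊆ torus) (w : unrolled L) : ↥(sphere \ L) :=
  ⟨(((√(2 - ‖w.1.2‖ ^ 2) : ℝ) : ℂ) * Complex.exp ((w.1.1 : ℂ) * Complex.I), w.1.2), by
    obtain ⟨⟨s, w⟩, hw⟩ := w
    have hw2 : ‖w‖ ^ 2 < 2 := by
      rcases hw with h | ⟨-, h, -⟩
      · have : ‖w‖ < 1 := h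
        nlinarith [norm_nonneg w]
      · exact h
    refine ⟨?_, fun h => ?_⟩
    · change ‖((√(2 - ‖w‖ ^ 2) : ℝ) : ℂ) * Complex.exp ((s : ℂ) * Complex.I)‖ ^ 2 + ‖w‖ ^ 2 = 2
      rw [norm_mul, Complex.norm_exp_ofReal_mul_I, mul_one, Complex.norm_real,
        Real.norm_of_nonneg (Real.sqrt_nonneg _), Real.sq_sqrt (by linarith)]
      ring
    · have h' : ((((√(2 - ‖w‖ ^ 2) : ℝ) : ℂ) * Complex.exp ((s : ℂ) * Complex.I), w) : ℂ × ℂ)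
          ∈ L := h
      have h1 : ‖w‖ = 1 := (hL h').2
      clear h
      rcases hw with h2 | ⟨-, -, h2⟩
      · exact absurd h1 (ne_of_lt h2)
      · have e : ((((√(2 - ‖w‖ ^ 2) : ℝ) : ℂ) * Complex.exp ((s : ℂ) * Complex.I), w) : ℂ × ℂ)
            = (Complex.exp ((s : ℂ) * Complex.I), w / (‖w‖ : ℂ)) := by
          rw [h1]
          norm_num
        exact h2 (e ▸ h')⟩

lemma continuous_rolled (hL : L ⊆ torus) : Continuous (rolled hL) := by
  unfold rolled
  fun_prop

/-- The solid torus `|v| < 1`, enlarged by the collar of the complement of `L` in the standard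
torus. -/
def thickSolid (L : Set (ℂ × ℂ)) : Set ↥(sphere \ L) := {z | ‖z.1.2‖ < 1 ∨ z.1 ∈ collar L}

lemma fst_ne_zero {z : ↥(sphere \ L)} (hz : z ∈ thickSolid L) : z.1.1 ≠ 0 := by
  rcases hz with h | h
  · intro h0
    have h1 : ‖z.1.1‖ ^ 2 + ‖z.1.2‖ ^ 2 = 2 := z.2.1
    rw [h0, norm_zero] at h1
    nlinarith [norm_nonneg z.1.2]
  · exact h.1

lemma exists_unrolled (hL : L ⊆ torus) {z : ↥(sphere \ L)} (hz : z ∈ thickSolid L) {s : ℝ}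
    (hs : IsArg z.1.1 s) : ∃ h : (s, z.1.2) ∈ unrolled L, rolled hL ⟨_, h⟩ = z := by
  have h0 := fst_ne_zero hz
  have h1 : ‖z.1.1‖ ^ 2 + ‖z.1.2‖ ^ 2 = 2 := z.2.1
  have h2 : 0 < ‖z.1.1‖ := norm_pos_iff.2 h0
  refine ⟨?_, Subtype.ext (Prod.ext ?_ rfl)⟩
  · rcases hz with h | ⟨-, h, h'⟩
    · exact .inl h
    · rw [hs.div_norm h0] at h'
      exact .inr ⟨h, by change ‖z.1.2‖ ^ 2 < 2; nlinarith, h'⟩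
  · change ((√(2 - ‖z.1.2‖ ^ 2) : ℝ) : ℂ) * Complex.exp ((s : ℂ) * Complex.I) = z.1.1
    rw [show 2 - ‖z.1.2‖ ^ 2 = ‖z.1.1‖ ^ 2 by linarith, Real.sqrt_sq h2.le]
    exact hs.symm

lemma rolled_mem (hL : L ⊆ torus) (w : unrolled L) : rolled hL w ∈ thickSolid L := by
  obtain ⟨⟨s, w⟩, hw⟩ := w
  rcases hw with h | ⟨h1, h2, h3⟩
  · exact .inl h
  · have hpos : 0 < √(2 - ‖w‖ ^ 2) := Real.sqrt_pos.2 (sub_pos.2 h2)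
    have hne : ((√(2 - ‖w‖ ^ 2) : ℝ) : ℂ) * Complex.exp ((s : ℂ) * Complex.I) ≠ 0 :=
      mul_ne_zero (by exact_mod_cast hpos.ne') (Complex.exp_ne_zero _)
    refine .inr ⟨hne, h1, ?_⟩
    have h4 := (isArg_mul_exp hpos.le s).div_norm hne
    exact fun h => h3 (by rw [← h4]; exact h)

/-- The thickened solid torus as a circle piece: its universal covering is contractible. -/
noncomputable def pieceA (hL : L ⊆ torus) (hLc : IsClosed L) : CirclePiece ↥(sphere \ L) where
  carrier := thickSolid L
  angle z := z.1.1
  isOpen := by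
    refine (isOpen_Iio.preimage (f := fun z : ↥(sphere \ L) => ‖z.1.2‖) (by fun_prop)).union
      ((isOpen_collar hLc).preimage continuous_subtype_val)
  continuous_angle := by fun_prop
  ne_zero z hz := fst_ne_zero hz
  exists_path x hx y hy s₀ s₁ hs₀ hs₁ := by
    obtain ⟨hx', ex⟩ := exists_unrolled hL hx hs₀
    obtain ⟨hy', ey⟩ := exists_unrolled hL hy hs₁
    let Γ : Path (⟨_, hx'⟩ : unrolled L) ⟨_, hy'⟩ := PathConnectedSpace.somePath _ _
    refine ⟨(Γ.map (continuous_rolled hL)).cast ex.symm ey.symm,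
      ⟨fun t => (Γ t).1.1, by fun_prop⟩, fun t => rolled_mem hL _, fun t =>
      isArg_mul_exp (Real.sqrt_nonneg _) _, ?_, ?_⟩
    · change (Γ 0).1.1 = s₀
      rw [Γ.source]
    · change (Γ 1).1.1 = s₁
      rw [Γ.target]
  homotopic {x y} γ γ' s s' hγ hγ' hs hs' h0 h1 := by
    choose m e using fun t => exists_unrolled hL (hγ t) (hs t)
    choose m' e' using fun t => exists_unrolled hL (hγ' t) (hs' t)
    have hx : ((s' 0, (γ' 0).1.2) : ℝ × ℂ) = (s 0, (γ 0).1.2) := by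
      rw [h0, γ.source, γ'.source]
    have hy : ((s' 1, (γ' 1).1.2) : ℝ × ℂ) = (s 1, (γ 1).1.2) := by
      rw [h1, γ.target, γ'.target]
    let Γ : Path (⟨_, m 0⟩ : unrolled L) ⟨_, m 1⟩ :=
      ⟨⟨fun t => ⟨_, m t⟩, by fun_prop⟩, rfl, rfl⟩
    let Γ' : Path (⟨_, m 0⟩ : unrolled L) ⟨_, m 1⟩ :=
      ⟨⟨fun t => ⟨_, m' t⟩, by fun_prop⟩, Subtype.ext hx, Subtype.ext hy⟩
    have h := (SimplyConnectedSpace.paths_homotopic Γ Γ').map ⟨_, continuous_rolled hL⟩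
    have := h.pathCast ((e 0).trans γ.source).symm ((e 1).trans γ.target).symm
    convert this using 1
    · ext1
      exact funext fun t => (e t).symm
    · ext1
      exact funext fun t => (e' t).symm

/-- Exchanging the two coordinates of `ℂ²`. -/
noncomputable def swapHomeo (L : Set (ℂ × ℂ)) : ↥(sphere \ L) ≃ₜ ↥(sphere \ (Prod.swap ⁻¹' L)) where
  toFun z := ⟨z.1.swap, (add_comm _ _).trans z.2.1, z.2.2⟩
  invFun z := ⟨z.1.swap, (add_comm _ _).trans z.2.1, z.2.2⟩
  left_inv _ := rfl
  right_inv _ := rfl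
  continuous_toFun := by fun_prop
  continuous_invFun := by fun_prop

lemma swap_preimage_subset (hL : L ⊆ torus) : Prod.swap ⁻¹' L ⊆ torus :=
  fun _ hz => ⟨(hL hz).2, (hL hz).1⟩

/-- The other thickened solid torus. -/
noncomputable def pieceB (hL : L ⊆ torus) (hLc : IsClosed L) : CirclePiece ↥(sphere \ L) :=
  (pieceA (swap_preimage_subset hL) (hLc.preimage continuous_swap)).comap (swapHomeo L)

lemma mem_pieceA {hL : L ⊆ torus} {hLc : IsClosed L} {z : ↥(sphere \ L)} :
    z ∈ (pieceA hL hLc).carrier ↔ ‖z.1.2‖ < 1 ∨ z.1 ∈ collar L := Iff.rfl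

lemma mem_pieceB {hL : L ⊆ torus} {hLc : IsClosed L} {z : ↥(sphere \ L)} :
    z ∈ (pieceB hL hLc).carrier ↔ ‖z.1.1‖ < 1 ∨ z.1 ∈ collar L := by
  change _ ∨ (_ ∧ _ ∧ _) ↔ _ ∨ (_ ∧ _ ∧ _)
  exact or_congr Iff.rfl and_left_comm

lemma mem_pieceA_or_mem_pieceB (hL : L ⊆ torus) (hLc : IsClosed L) (z : ↥(sphere \ L)) :
    z ∈ (pieceA hL hLc).carrier ∨ z ∈ (pieceB hL hLc).carrier := by
  have h : ‖z.1.1‖ ^ 2 + ‖z.1.2‖ ^ 2 = 2 := z.2.1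
  rw [mem_pieceA, mem_pieceB]
  rcases lt_or_ge ‖z.1.2‖ 1 with h2 | h2
  · exact .inl (.inl h2)
  rcases lt_or_ge ‖z.1.1‖ 1 with h1 | h1
  · exact .inr (.inl h1)
  · have e1 : ‖z.1.1‖ = 1 := by nlinarith
    have e2 : ‖z.1.2‖ = 1 := by nlinarith
    refine .inl (.inr ⟨norm_pos_iff.1 (by linarith), norm_pos_iff.1 (by linarith), ?_⟩)
    rw [e1, e2]
    simpa using z.2.2

lemma mem_collar_of_mem {hL : L ⊆ torus} {hLc : IsClosed L} {z : ↥(sphere \ L)}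
    (hA : z ∈ (pieceA hL hLc).carrier) (hB : z ∈ (pieceB hL hLc).carrier) : z.1 ∈ collar L := by
  have h : ‖z.1.1‖ ^ 2 + ‖z.1.2‖ ^ 2 = 2 := z.2.1
  rcases hA with hA | hA
  · rcases mem_pieceB.1 hB with hB | hB
    · nlinarith [norm_nonneg z.1.1, norm_nonneg z.1.2]
    · exact hB
  · exact hA

end TorusLink

/-! ### The splitting of a torus link complement -/

namespace TorusLink

open Filter Topology

variable {n : ℕ} {p q : ℤ}

lemma link_subset_torus (n : ℕ) (p q : ℤ) : link n p q ⊆ torus := by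
  intro z hz
  obtain ⟨k, θ, ψ, rfl, -⟩ := Set.mem_iUnion.1 hz
  exact ⟨Complex.norm_exp_ofReal_mul_I θ, Complex.norm_exp_ofReal_mul_I ψ⟩

lemma mem_link_iff (hn : 0 < n) (s t : ℝ) :
    ((Complex.exp (s * Complex.I), Complex.exp (t * Complex.I)) : ℂ × ℂ) ∈ link n p q ↔
      ∃ K : ℤ, height n p q s t = K := by
  have : NeZero n := ⟨hn.ne'⟩
  have hpi := Real.pi_ne_zero
  have hn' : (n : ℝ) ≠ 0 := by exact_mod_cast hn.ne'
  have arg_eq : ∀ {a b : ℝ}, Complex.exp (a * Complex.I) = Complex.exp (b * Complex.I) →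
      ∃ i : ℤ, b = a + 2 * Real.pi * i := fun {a b} h => by
    have ha : IsArg (Complex.exp (a * Complex.I)) a := by
      simpa using isArg_mul_exp zero_le_one a
    have hb : IsArg (Complex.exp (a * Complex.I)) b := by
      rw [h]
      simpa using isArg_mul_exp zero_le_one b
    exact ha.exists_int (Complex.exp_ne_zero _) hb
  constructor
  · intro h
    obtain ⟨k, θ, ψ, hz, m, hm⟩ := Set.mem_iUnion.1 h
    obtain ⟨i, rfl⟩ := arg_eq (congrArg Prod.fst hz)
    obtain ⟨j, rfl⟩ := arg_eq (congrArg Prod.snd hz)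
    refine ⟨k.val + n * m - n * (q * i - p * j), ?_⟩
    have h1 := height_add_int n p q s t i j
    have h2 : height n p q (s + 2 * Real.pi * i) (t + 2 * Real.pi * j) = k.val + n * m := by
      rw [height, hm]
      field_simp
    rw [h2] at h1
    push_cast at h1 ⊢
    linarith
  · rintro ⟨K, hK⟩
    refine Set.mem_iUnion.2 ⟨(K : ZMod n), s, t, rfl, K / n, ?_⟩
    have h1 : (((K : ZMod n).val : ℤ) : ℝ) = ((K % n : ℤ) : ℝ) := by rw [ZMod.val_intCast]
    have h2 : ((K % n : ℤ) : ℝ) + n * ((K / n : ℤ) : ℝ) = K := by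
      exact_mod_cast Int.emod_add_mul_ediv K n
    rw [Int.cast_natCast] at h1
    rw [height, div_eq_iff (by positivity)] at hK
    rw [h1]
    have h3 : (n : ℝ) * (q * s - p * t) = n * (2 * Real.pi * (((K % n : ℤ) : ℝ) / n)
        + 2 * Real.pi * ((K / n : ℤ) : ℝ)) := by
      rw [hK, ← h2]
      field_simp
    exact mul_left_cancel₀ hn' h3

/-- The link is cut out of the torus by the equation `u ^ (n q) = v ^ (n p)`. -/
lemma isClosed_link (hn : 0 < n) (p q : ℤ) : IsClosed (link n p q) := by
  have hpi := Real.pi_ne_zero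
  have hT : IsClosed torus :=
    (isClosed_eq (f := fun z : ℂ × ℂ => ‖z.1‖) (g := fun _ => 1) (by fun_prop)
      (by fun_prop)).inter
    (isClosed_eq (f := fun z : ℂ × ℂ => ‖z.2‖) (g := fun _ => 1) (by fun_prop) (by fun_prop))
  have hne : ∀ z ∈ torus, z.1 ≠ 0 ∧ z.2 ≠ 0 := fun z hz =>
    ⟨norm_ne_zero_iff.1 (by rw [hz.1]; exact one_ne_zero),
      norm_ne_zero_iff.1 (by rw [hz.2]; exact one_ne_zero)⟩
  have hc : ContinuousOn (fun z : ℂ × ℂ => z.1 ^ (n * q : ℤ) * z.2 ^ (-(n * p) : ℤ)) torus :=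
    (continuousOn_fst.zpow₀ _ fun z hz => .inl (hne z hz).1).mul
      (continuousOn_snd.zpow₀ _ fun z hz => .inl (hne z hz).2)
  convert hc.preimage_isClosed_of_isClosed hT (isClosed_singleton (x := 1)) using 1
  ext z
  have key : ∀ s t : ℝ, (Complex.exp (s * Complex.I), Complex.exp (t * Complex.I)) ∈ link n p q ↔
      Complex.exp (s * Complex.I) ^ (n * q : ℤ) * Complex.exp (t * Complex.I) ^ (-(n * p) : ℤ)
        = 1 := by
    intro s t
    rw [mem_link_iff hn, ← Complex.exp_int_mul, ← Complex.exp_int_mul, ← Complex.exp_add,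
      Complex.exp_eq_one_iff]
    refine exists_congr fun K => ?_
    rw [height, div_eq_iff (by positivity)]
    have h1 : ((n * q : ℤ) : ℂ) * (s * Complex.I) + ((-(n * p) : ℤ) : ℂ) * (t * Complex.I)
        = ((n * (q * s - p * t) : ℝ) : ℂ) * Complex.I := by
      push_cast
      ring
    have h2 : (K : ℂ) * (2 * Real.pi * Complex.I)
        = ((K * (2 * Real.pi) : ℝ) : ℂ) * Complex.I := by
      push_cast
      ring
    rw [h1, h2, mul_left_inj' Complex.I_ne_zero, Complex.ofReal_inj]
  have hz : z ∈ torus → (Complex.exp (z.1.arg * Complex.I), Complex.exp (z.2.arg * Complex.I)) = z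
      := fun hz => by
    have h1 := isArg_arg z.1
    have h2 := isArg_arg z.2
    rw [IsArg, hz.1] at h1
    rw [IsArg, hz.2] at h2
    exact Prod.ext (by simpa using h1.symm) (by simpa using h2.symm)
  constructor
  · intro h
    have hzt := link_subset_torus n p q h
    refine ⟨hzt, ?_⟩
    have := (key z.1.arg z.2.arg).1 (by rwa [hz hzt])
    rw [← hz hzt]
    exact this
  · rintro ⟨hzt, h⟩
    rw [← hz hzt] at h ⊢
    exact (key _ _).2 h

/-- The point of the sphere with arguments `s`, `t` and with second coordinate of norm `r`. -/
noncomputable def polar (r s t : ℝ) : ℂ × ℂ :=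
  (((√(2 - r ^ 2) : ℝ) : ℂ) * Complex.exp (s * Complex.I), (r : ℂ) * Complex.exp (t * Complex.I))

lemma continuous_polar : Continuous fun P : ℝ × ℝ × ℝ => polar P.1 P.2.1 P.2.2 := by
  unfold polar
  fun_prop

lemma norm_polar_fst (r s t : ℝ) : ‖(polar r s t).1‖ = √(2 - r ^ 2) := by
  rw [polar, norm_mul, Complex.norm_exp_ofReal_mul_I, mul_one, Complex.norm_real,
    Real.norm_of_nonneg (Real.sqrt_nonneg _)]

lemma norm_polar_snd {r : ℝ} (hr : 0 ≤ r) (s t : ℝ) : ‖(polar r s t).2‖ = r := by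
  rw [polar, norm_mul, Complex.norm_exp_ofReal_mul_I, mul_one, Complex.norm_real,
    Real.norm_of_nonneg hr]

lemma isArg_polar_fst (r s t : ℝ) : IsArg (polar r s t).1 s :=
  isArg_mul_exp (Real.sqrt_nonneg _) s

lemma isArg_polar_snd {r : ℝ} (hr : 0 ≤ r) (s t : ℝ) : IsArg (polar r s t).2 t :=
  isArg_mul_exp hr t

lemma eq_polar {z : ℂ × ℂ} (hz : z ∈ sphere) {s t : ℝ} (hs : IsArg z.1 s) (ht : IsArg z.2 t) :
    z = polar ‖z.2‖ s t := by
  have h : ‖z.1‖ ^ 2 + ‖z.2‖ ^ 2 = 2 := hz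
  refine Prod.ext ?_ ht
  change z.1 = ((√(2 - ‖z.2‖ ^ 2) : ℝ) : ℂ) * Complex.exp (s * Complex.I)
  rw [show 2 - ‖z.2‖ ^ 2 = ‖z.1‖ ^ 2 by linarith, Real.sqrt_sq (norm_nonneg _)]
  exact hs

lemma sq_lt_two {r : ℝ} (hr : r ∈ Set.Ioo 0 √2) : r ^ 2 < 2 := by
  have := Real.sq_sqrt (show (0 : ℝ) ≤ 2 by norm_num)
  nlinarith [hr.1, hr.2]

lemma polar_mem_sphere {r : ℝ} (hr : r ∈ Set.Ioo 0 √2) (s t : ℝ) : polar r s t ∈ sphere := by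
  have h2 := sq_lt_two hr
  change ‖(polar r s t).1‖ ^ 2 + ‖(polar r s t).2‖ ^ 2 = 2
  rw [norm_polar_fst, norm_polar_snd hr.1.le, Real.sq_sqrt (by linarith)]
  ring

lemma polar_mem_collar (hn : 0 < n) {r s t : ℝ} (hr : r ∈ Set.Ioo 0 √2)
    (h : ∀ K : ℤ, height n p q s t ≠ K) : polar r s t ∈ collar (link n p q) := by
  have h2 := sq_lt_two hr
  have h1 : (polar r s t).1 ≠ 0 := by
    rw [← norm_ne_zero_iff, norm_polar_fst]
    exact (Real.sqrt_pos.2 (by linarith)).ne'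
  have h3 : (polar r s t).2 ≠ 0 := by
    rw [← norm_ne_zero_iff, norm_polar_snd hr.1.le]
    exact hr.1.ne'
  refine ⟨h1, h3, ?_⟩
  rw [(isArg_polar_fst r s t).div_norm h1, (isArg_polar_snd hr.1.le s t).div_norm h3,
    mem_link_iff hn]
  exact fun ⟨K, hK⟩ => h K hK

lemma polar_mem_complement (hn : 0 < n) {r s t : ℝ} (hr : r ∈ Set.Ioo 0 √2)
    (h : ∀ K : ℤ, height n p q s t ≠ K) : polar r s t ∈ sphere \ link n p q := by
  refine ⟨polar_mem_sphere hr s t, fun hL => (polar_mem_collar hn hr h).2.2 ?_⟩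
  obtain ⟨h1, h2⟩ := link_subset_torus n p q hL
  rw [h1, h2]
  simpa using hL

lemma height_ne_of_mem_collar (hn : 0 < n) {z : ℂ × ℂ} (hz : z ∈ collar (link n p q)) {s t : ℝ}
    (hs : IsArg z.1 s) (ht : IsArg z.2 t) (K : ℤ) : height n p q s t ≠ K := by
  intro hK
  obtain ⟨h1, h2, h3⟩ := hz
  rw [hs.div_norm h1, ht.div_norm h2, mem_link_iff hn] at h3
  exact h3 ⟨K, hK⟩

lemma norm_snd_mem_Ioo {z : ℂ × ℂ} (hz : z ∈ sphere) (h1 : z.1 ≠ 0) (h2 : z.2 ≠ 0) :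
    ‖z.2‖ ∈ Set.Ioo 0 √2 := by
  have h : ‖z.1‖ ^ 2 + ‖z.2‖ ^ 2 = 2 := hz
  have := norm_pos_iff.2 h1
  exact ⟨norm_pos_iff.2 h2, Real.lt_sqrt_of_sq_lt (by nlinarith)⟩

/-- The affine interpolation from `a` to `b`. -/
def interp (a b : ℝ) (τ : I) : ℝ := (1 - (τ : ℝ)) * a + (τ : ℝ) * b

lemma interp_mem {D : Set ℝ} (hD : Convex ℝ D) {a b : ℝ} (ha : a ∈ D) (hb : b ∈ D) (τ : I) :
    interp a b τ ∈ D :=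
  hD ha hb (by linarith [τ.2.2]) τ.2.1 (by ring)

lemma continuous_interp (a b : ℝ) : Continuous (interp a b) := by
  unfold interp
  fun_prop

lemma height_interp_ne {s t s' t' : ℝ} (h : ∀ K : ℤ, height n p q s t ≠ K)
    (h' : ∀ K : ℤ, height n p q s' t' ≠ K) (hfl : ⌊height n p q s t⌋ = ⌊height n p q s' t'⌋)
    (τ : I) (K : ℤ) : height n p q (interp s s' τ) (interp t t' τ) ≠ K := by
  have hlin : height n p q (interp s s' τ) (interp t t' τ)
      = interp (height n p q s t) (height n p q s' t') τ := by
    unfold height interp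
    ring
  have hm : ∀ {a : ℝ}, (∀ K : ℤ, a ≠ K) → a ∈ Set.Ioo (⌊a⌋ : ℝ) (⌊a⌋ + 1) := fun {a} ha =>
    ⟨lt_of_le_of_ne (Int.floor_le a) (ha _).symm, Int.lt_floor_add_one a⟩
  have h1 := hm h
  rw [hfl] at h1
  have h2 := interp_mem (convex_Ioo _ _) h1 (hm h') τ
  rw [hlin]
  intro hK
  rw [hK] at h2
  obtain ⟨h3, h4⟩ := h2
  have h5 : ⌊height n p q s' t'⌋ < K := by exact_mod_cast h3
  have h6 : K < ⌊height n p q s' t'⌋ + 1 := by exact_mod_cast h4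
  omega

/-- The splitting of the complement of a torus link into the two thickened solid tori. -/
noncomputable def splitting (hn : 0 < n) (p q : ℤ) : StripSplitting n p q (Complement n p q) where
  U := pieceA (link_subset_torus n p q) (isClosed_link hn p q)
  V := pieceB (link_subset_torus n p q) (isClosed_link hn p q)
  cover := mem_pieceA_or_mem_pieceB _ _
  height_ne x hU hV s t hs ht := height_ne_of_mem_collar hn (mem_collar_of_mem hU hV) hs ht
  join x hxU hxV y hyU hyV s t s' t' hs ht hs' ht' hfl := by
    have hx := mem_collar_of_mem hxU hxV
    have hy := mem_collar_of_mem hyU hyV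
    have hr := fun τ => interp_mem (convex_Ioo _ _) (norm_snd_mem_Ioo x.2.1 hx.1 hx.2.1)
      (norm_snd_mem_Ioo y.2.1 hy.1 hy.2.1) τ
    have hh := height_interp_ne (height_ne_of_mem_collar hn hx hs ht)
      (height_ne_of_mem_collar hn hy hs' ht') hfl
    let γ : Path x y :=
      { toFun := fun τ => ⟨_, polar_mem_complement hn (hr τ) (hh τ)⟩
        continuous_toFun := (continuous_polar.comp ((continuous_interp _ _).prodMk
          ((continuous_interp _ _).prodMk (continuous_interp _ _)))).subtype_mk _
        source' := Subtype.ext <| by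
          simpa [interp] using (eq_polar x.2.1 hs ht).symm
        target' := Subtype.ext <| by
          simpa [interp] using (eq_polar y.2.1 hs' ht').symm }
    have hγ : ∀ τ, (γ τ).1 ∈ collar (link n p q) := fun τ => polar_mem_collar hn (hr τ) (hh τ)
    exact ⟨.mk γ, ⟨γ, rfl, fun τ => .inr (hγ τ), ⟨_, continuous_interp s s'⟩,
        fun τ => isArg_polar_fst _ _ (interp t t' τ), by simp [interp]⟩,
      ⟨γ, rfl, fun τ => mem_pieceB.2 (.inr (hγ τ)), ⟨_, continuous_interp t t'⟩,
        fun τ => isArg_polar_snd (hr τ).1.le (interp s s' τ) _, by simp [interp]⟩⟩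

end TorusLink

/-! ### Markings of the link complement and the presentations -/

namespace TorusLink

open Filter Topology

variable {n : ℕ} {p q : ℤ}

lemma mem_collar_of_mem_regionC {z : ℂ × ℂ} (hz : z ∈ regionC n p q) :
    z ∈ collar (link n p q) := by
  obtain ⟨⟨h1, h2⟩, h3⟩ := hz
  refine ⟨norm_pos_iff.1 (by linarith), norm_pos_iff.1 (by linarith), ?_⟩
  rw [h1, h2]
  simpa using h3

lemma mem_splitting_U {hn : 0 < n} {z : Complement n p q} :
    z ∈ (splitting hn p q).U.carrier ↔ ‖z.1.2‖ < 1 ∨ z.1 ∈ collar (link n p q) := Iff.rfl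

lemma mem_splitting_V {hn : 0 < n} {z : Complement n p q} :
    z ∈ (splitting hn p q).V.carrier ↔ ‖z.1.1‖ < 1 ∨ z.1 ∈ collar (link n p q) :=
  mem_pieceB (hL := link_subset_torus n p q) (hLc := isClosed_link hn p q)

lemma mem_U_of_mem_regionA (hn : 0 < n) {z : Complement n p q} (hz : z.1 ∈ regionA n p q) :
    z ∈ (splitting hn p q).U.carrier :=
  mem_splitting_U.2 (hz.imp (fun h => h.2) mem_collar_of_mem_regionC)

lemma mem_V_of_mem_regionB (hn : 0 < n) {z : Complement n p q} (hz : z.1 ∈ regionB n p q) :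
    z ∈ (splitting hn p q).V.carrier :=
  mem_splitting_V.2 (hz.imp (fun h => h.2) mem_collar_of_mem_regionC)

/-- Points of the torus with arguments of the same integer height are joined in the complement
of the link in the torus. -/
lemma joinedIn_regionC (hn : 0 < n) {z z' : ℂ × ℂ} (hz : z ∈ regionC n p q)
    (hz' : z' ∈ regionC n p q) {s t s' t' : ℝ} (hs : IsArg z.1 s) (ht : IsArg z.2 t)
    (hs' : IsArg z'.1 s') (ht' : IsArg z'.2 t')
    (hfl : ⌊height n p q s t⌋ = ⌊height n p q s' t'⌋) : JoinedIn (regionC n p q) z z' := by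
  have hh := height_interp_ne (height_ne_of_mem_collar hn (mem_collar_of_mem_regionC hz) hs ht)
    (height_ne_of_mem_collar hn (mem_collar_of_mem_regionC hz') hs' ht') hfl
  have hsp : ∀ {w : ℂ × ℂ}, w ∈ regionC n p q → w ∈ sphere := fun {w} hw => by
    change ‖w.1‖ ^ 2 + ‖w.2‖ ^ 2 = 2
    rw [hw.1.1, hw.1.2]
    norm_num
  have e := eq_polar (hsp hz) hs ht
  have e' := eq_polar (hsp hz') hs' ht'
  rw [hz.1.2] at e
  rw [hz'.1.2] at e'
  refine ⟨{ toFun := fun τ => polar 1 (interp s s' τ) (interp t t' τ)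
            continuous_toFun := continuous_polar.comp (continuous_const.prodMk
              ((continuous_interp _ _).prodMk (continuous_interp _ _)))
            source' := by simpa [interp] using e.symm
            target' := by simpa [interp] using e'.symm }, fun τ => ⟨⟨?_, ?_⟩, ?_⟩⟩
  · change ‖(polar 1 _ _).1‖ = 1
    rw [norm_polar_fst]
    norm_num
  · exact norm_polar_snd zero_le_one _ _
  · exact (polar_mem_complement hn ⟨zero_lt_one, Real.lt_sqrt_of_sq_lt (by norm_num)⟩ (hh τ)).2

/-- The marking given by base points in the components of the complement of the link in the torus
and by paths in the two solid tori. -/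
noncomputable def markingOfPaths (hn : 0 < n) (hpq : IsCoprime p q)
    (x : ZMod n → Complement n p q) (hx : ∀ k, (x k : ℂ × ℂ) ∈ regionC n p q)
    (hx' : ∀ z ∈ regionC n p q, ∃! k, JoinedIn (regionC n p q) (x k : ℂ × ℂ) z)
    (α β : Path (x 0) (x 0))
    (hα : ∀ t, (α t : ℂ × ℂ) ∈ regionA n p q) (hα' : WindsOnce fun t => (α t : ℂ × ℂ).1)
    (hβ : ∀ t, (β t : ℂ × ℂ) ∈ regionB n p q) (hβ' : WindsOnce fun t => (β t : ℂ × ℂ).2)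
    (a b : ∀ k, Path (x 0) (x k)) (ha : ∀ k t, (a k t : ℂ × ℂ) ∈ regionA n p q)
    (hb : ∀ k t, (b k t : ℂ × ℂ) ∈ regionB n p q) (ha0 : a 0 = Path.refl (x 0))
    (hb0 : b 0 = Path.refl (x 0)) : (splitting hn p q).Marking x where
  α := α
  β := β
  a := a
  b := b
  winds_α := ⟨α, rfl, fun t => mem_U_of_mem_regionA hn (hα t), hα'.2⟩
  winds_β := ⟨β, rfl, fun t => mem_V_of_mem_regionB hn (hβ t), hβ'.2⟩
  winds_a k := CirclePiece.exists_winds _ fun t => mem_U_of_mem_regionA hn (ha k t)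
  winds_b k := CirclePiece.exists_winds _ fun t => mem_V_of_mem_regionB hn (hb k t)
  a_zero := ha0
  b_zero := hb0
  eq_of_floor k l s t s' t' hs ht hs' ht' h := by
    obtain ⟨e, c, hec⟩ := hpq
    obtain ⟨m, hm⟩ := (ZMod.intCast_eq_intCast_iff_dvd_sub _ _ _).1 h
    have hfl := floor_height_add_int n p q s t (c * m) (-e * m)
    rw [show q * (c * m) - p * (-e * m) = m by linear_combination m * hec, ← hm,
      add_sub_cancel] at hfl
    exact (hx' _ (hx l)).unique (joinedIn_regionC hn (hx k) (hx l) (hs.add_int _) (ht.add_int _)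
      hs' ht' hfl) (JoinedIn.refl (hx l))

theorem exists_marking (hn : 0 < n) (hpq : IsCoprime p q) :
    ∃ x : ZMod n → Complement n p q, Nonempty ((splitting hn p q).Marking x) := by
  have : NeZero n := ⟨hn.ne'⟩
  have hn' : (n : ℝ) ≠ 0 := by exact_mod_cast hn.ne'
  have hpi := Real.pi_ne_zero
  obtain ⟨e, c, hec⟩ := hpq
  have hec' : (e : ℝ) * p + c * q = 1 := by exact_mod_cast hec
  -- Points of height `k + 1 / 2`.
  let s : ZMod n → ℝ := fun k => 2 * Real.pi * ((k.val + 1 / 2) / n * c)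
  let t : ZMod n → ℝ := fun k => 2 * Real.pi * ((k.val + 1 / 2) / n * -e)
  have hst : ∀ k, height n p q (s k) (t k) = k.val + 1 / 2 := fun k => by
    simp only [height, s, t]
    field_simp
    linear_combination hec'
  have hfl : ∀ k, ⌊height n p q (s k) (t k)⌋ = k.val := fun k => by
    rw [hst, Int.floor_eq_iff]
    constructor <;> push_cast <;> linarith
  have hne : ∀ k (K : ℤ), height n p q (s k) (t k) ≠ K := fun k K hK => by
    have h1 := hfl k
    rw [hK, Int.floor_intCast] at h1
    rw [hst, h1, Int.cast_natCast] at hK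
    linarith
  have h1 : (1 : ℝ) ∈ Set.Ioo 0 √2 := ⟨zero_lt_one, Real.lt_sqrt_of_sq_lt (by norm_num)⟩
  let x : ZMod n → Complement n p q := fun k => ⟨_, polar_mem_complement hn h1 (hne k)⟩
  have hxc : ∀ k, (x k).1 ∈ collar (link n p q) := fun k => polar_mem_collar hn h1 (hne k)
  have hxU : ∀ k, x k ∈ (splitting hn p q).U.carrier := fun k => mem_splitting_U.2 (.inr (hxc k))
  have hxV : ∀ k, x k ∈ (splitting hn p q).V.carrier := fun k => mem_splitting_V.2 (.inr (hxc k))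
  have hxs : ∀ k, IsArg ((splitting hn p q).U.angle (x k)) (s k) := fun k =>
    isArg_polar_fst 1 (s k) (t k)
  have hxt : ∀ k, IsArg ((splitting hn p q).V.angle (x k)) (t k) := fun k =>
    isArg_polar_snd zero_le_one (s k) (t k)
  obtain ⟨α, hα⟩ := CirclePiece.exists_path_winds (hxU 0) (hxU 0) (hxs 0) ((hxs 0).add_int 1)
  obtain ⟨β, hβ⟩ := CirclePiece.exists_path_winds (hxV 0) (hxV 0) (hxt 0) ((hxt 0).add_int 1)
  choose a ha using fun k =>
    CirclePiece.exists_path_winds (hxU 0) (hxU k) (hxs 0) (hxs k)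
  choose b hb using fun k =>
    CirclePiece.exists_path_winds (hxV 0) (hxV k) (hxt 0) (hxt k)
  rw [Int.cast_one, mul_one, add_sub_cancel_left] at hα hβ
  have upd : ∀ {P : CirclePiece (Complement n p q)} (a : ∀ k, Path (x 0) (x k)),
      (∀ k, ∃ d, P.Winds (.mk (a k)) d) →
      ∀ k, ∃ d, P.Winds (.mk (Function.update a 0 (Path.refl (x 0)) k)) d := by
    intro P a ha k
    by_cases hk : k = 0
    · subst hk
      rw [Function.update_self]
      exact ⟨0, CirclePiece.Winds.refl (ha 0).choose_spec.source_mem⟩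
    · rw [Function.update_of_ne hk]
      exact ha k
  refine ⟨x, ⟨{
    α := α
    β := β
    a := Function.update a 0 (Path.refl (x 0))
    b := Function.update b 0 (Path.refl (x 0))
    winds_α := hα
    winds_β := hβ
    winds_a := upd a fun k => ⟨_, ha k⟩
    winds_b := upd b fun k => ⟨_, hb k⟩
    a_zero := Function.update_self ..
    b_zero := Function.update_self ..
    eq_of_floor := ?_ }⟩⟩
  have hres : ∀ k s' t', IsArg ((splitting hn p q).U.angle (x k)) s' →
      IsArg ((splitting hn p q).V.angle (x k)) t' →
      ((⌊height n p q s' t'⌋ : ℤ) : ZMod n) = k := by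
    intro k s' t' hs' ht'
    obtain ⟨i, rfl⟩ := (hxs k).exists_int (CirclePiece.ne_zero _ _ (hxU k)) hs'
    obtain ⟨j, rfl⟩ := (hxt k).exists_int (CirclePiece.ne_zero _ _ (hxV k)) ht'
    rw [floor_height_add_int, hfl]
    simp
  intro k l s₁ t₁ s₂ t₂ hs₁ ht₁ hs₂ ht₂ h
  rwa [hres k _ _ hs₁ ht₁, hres l _ _ hs₂ ht₂] at h

lemma StripSplitting.pathConnectedSpace {X : Type*} [TopologicalSpace X]
    (S : StripSplitting n p q X) {x : X} (hU : x ∈ S.U.carrier) (hV : x ∈ S.V.carrier) :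
    PathConnectedSpace X := by
  have h : ∀ y, Joined x y := fun y => by
    rcases S.cover y with hy | hy
    · exact ⟨(CirclePiece.exists_path_winds hU hy (isArg_arg _) (isArg_arg _)).choose⟩
    · exact ⟨(CirclePiece.exists_path_winds hV hy (isArg_arg _) (isArg_arg _)).choose⟩
  exact ⟨⟨x⟩, fun y z => (h y).symm.trans (h z)⟩

/-- For one component the generator `f 0` is trivial, and what remains is the presentation with
the two generators `α` and `β`. -/
lemma HasPresentation.knot {G : Type*} [Group G] {p q : ℤ} {g : Gen 1 → G}
    (h : HasPresentation g (linkRels 1 p q)) :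
    HasPresentation ![g .alpha, g .beta] (knotRels p q) := by
  obtain ⟨e, he⟩ := h
  have hf : ∀ k, (PresentedGroup.of (Gen.f k) : PresentedGroup (linkRels 1 p q)) = 1 := fun k => by
    rw [Subsingleton.elim k 0]
    exact PresentedGroup.one_of_mem (Or.inl rfl)
  have hk : (PresentedGroup.of 0 : PresentedGroup (knotRels p q)) ^ p
      * PresentedGroup.of 1 ^ (-q) = 1 := PresentedGroup.one_of_mem rfl
  let F : Gen 1 → PresentedGroup (knotRels p q)
    | .alpha => PresentedGroup.of 0
    | .beta => PresentedGroup.of 1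
    | .f _ => 1
  have hF : ∀ r ∈ linkRels 1 p q, FreeGroup.lift F r = 1 := by
    rintro r (rfl | ⟨k, rfl⟩)
    · simp [F]
    · simpa [F] using hk
  let F' : Fin 2 → PresentedGroup (linkRels 1 p q) :=
    ![PresentedGroup.of .alpha, PresentedGroup.of .beta]
  have hF' : ∀ r ∈ knotRels p q, FreeGroup.lift F' r = 1 := by
    rintro r rfl
    have h0 : (PresentedGroup.of Gen.alpha : PresentedGroup (linkRels 1 p q)) ^ p
        * PresentedGroup.of (Gen.f 0) * PresentedGroup.of Gen.beta ^ (-q)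
        * (PresentedGroup.of (Gen.f 0))⁻¹ = 1 := PresentedGroup.one_of_mem (Or.inr ⟨0, rfl⟩)
    rw [hf] at h0
    simpa [F'] using h0
  let E : PresentedGroup (knotRels p q) ≃* PresentedGroup (linkRels 1 p q) :=
    MonoidHom.toMulEquiv (PresentedGroup.toGroup hF') (PresentedGroup.toGroup hF)
      (by
        ext i
        fin_cases i <;> simp [F', F])
      (by
        ext i
        cases i <;> simp [F', F, hf])
  refine ⟨E.trans e, fun i => ?_⟩
  fin_cases i
  · exact (congrArg e (PresentedGroup.toGroup.of hF' (x := 0))).trans (he .alpha)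
  · exact (congrArg e (PresentedGroup.toGroup.of hF' (x := 1))).trans (he .beta)

end TorusLink

theorem theorem4p3 (n : ℕ) (hn : 0 < n) (p q : ℤ) (hpq : IsCoprime p q) :
    -- the presentation of the fundamental group, at every base point of the complement
    (∀ x : TorusLink.Complement n p q,
      Nonempty (FundamentalGroup (TorusLink.Complement n p q) x ≃*
        PresentedGroup (TorusLink.linkRels n p q))) ∧
    -- for one component: the torus knot group
    (n = 1 → ∀ x : TorusLink.Complement n p q,
      Nonempty (FundamentalGroup (TorusLink.Complement n p q) x ≃*
        PresentedGroup (TorusLink.knotRels p q))) ∧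
    -- the generators as loops: `x k` runs over one base point in each path component of `C`
    (∀ x : ZMod n → TorusLink.Complement n p q,
      (∀ k, (x k : ℂ × ℂ) ∈ TorusLink.regionC n p q) →
      (∀ z ∈ TorusLink.regionC n p q,
        ∃! k, JoinedIn (TorusLink.regionC n p q) (x k : ℂ × ℂ) z) →
      -- `α` is a loop in `A` winding once, `β` is a loop in `B` winding once
      ∀ α β : Path (x 0) (x 0),
      (∀ t, (α t : ℂ × ℂ) ∈ TorusLink.regionA n p q) →
      TorusLink.WindsOnce (fun t => (α t : ℂ × ℂ).1) →
      (∀ t, (β t : ℂ × ℂ) ∈ TorusLink.regionB n p q) →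
      TorusLink.WindsOnce (fun t => (β t : ℂ × ℂ).2) →
      -- `a k` and `b k` are paths from `x 0` to `x k` in `A` and in `B`, constant for `k = 0`
      ∀ a b : ∀ k, Path (x 0) (x k),
      (∀ k t, (a k t : ℂ × ℂ) ∈ TorusLink.regionA n p q) →
      (∀ k t, (b k t : ℂ × ℂ) ∈ TorusLink.regionB n p q) →
      a 0 = Path.refl (x 0) → b 0 = Path.refl (x 0) →
      TorusLink.HasPresentation (TorusLink.generators α β a b) (TorusLink.linkRels n p q) ∧
      (n = 1 → TorusLink.HasPresentation
        ![TorusLink.loopClass α, TorusLink.loopClass β] (TorusLink.knotRels p q))) := by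
  obtain ⟨x, ⟨M⟩⟩ := TorusLink.exists_marking hn hpq
  have := (TorusLink.splitting hn p q).pathConnectedSpace (M.memU 0) (M.memV 0)
  have hM := M.hasPresentation hn hpq
  refine ⟨fun y => ?_, ?_, ?_⟩
  · obtain ⟨e, -⟩ := hM
    exact ⟨(FundamentalGroup.fundamentalGroupMulEquivOfPathConnected y (x 0)).trans e.symm⟩
  · rintro rfl y
    obtain ⟨e, -⟩ := hM.knot
    exact ⟨(FundamentalGroup.fundamentalGroupMulEquivOfPathConnected y (x 0)).trans e.symm⟩
  · intro x hx hx' α β hα hα' hβ hβ' a b ha hb ha0 hb0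
    have h := (TorusLink.markingOfPaths hn hpq x hx hx' α β hα hα' hβ hβ' a b ha hb ha0
      hb0).hasPresentation hn hpq
    refine ⟨h, ?_⟩
    rintro rfl
    exact h.knot
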